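/- **The logic DL-PA$^\|$.** Let $\mathbb P$ be a set of propositional variables. Formulas and programs are given by $$\varphi ::= p \mid \top \mid \neg\varphi \mid \varphi\lor\varphi \mid \langle\pi\rangle\varphi,$$ $$\pi ::= {+p} \mid {-p} \mid {+r_p} \mid {-r_p} \mid {+w_p} \mid {-w_p} \mid \varphi? \mid \varphi?? \mid \pi;\pi \mid \pi\cup\pi \mid \pi^* \mid \pi\|\pi \qquad (p\in\mathbb P).$$ $\mathbb P(\cdot)$ is the set of variables that occur in an expression. A model is $m=(R,W,V)$ with $W\subseteq R\subseteq\mathbb P$ and $V\subseteq\mathbb P$. Models $m_1,m_2$ are RW-disjoint if $W_1\cap R_2=W_2\cap R_1=\emptyset$. *Split*: $m\lhd (m_1,m_2)$ iff $m_1,m_2$ are RW-disjoint, $R=R_1\cup R_2$, $W=W_1\cup W_2$, $V=V_1=V_2$. *Merge*: $m\rhd (m_1,m_2)$ iff $m_1,m_2$ are RW-disjoint, $R=R_1\cup R_2$, $W=W_1\cup W_2$, $V_1\setminus W=V_2\setminus W$ and $V=(V_1\cap W_1)\cup(V_2\cap W_2)\cup(V_1\cap V_2)$. Further, $m\sim m'$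 iff $R=R'$, $W=W'$, $V\cap R=V'\cap R'$. Truth is Boolean, with $m\models p$ iff $p\in V$, and $m\models\langle\pi\rangle\varphi$ iff $m\,[\pi]\,m'$ and $m'\models\varphi$ for some $m'$. Programs are interpreted as follows (components not mentioned stay the same): - $+p$: $V'=V\cup\{p\}$, and $-p$: $V'=V\setminus\{p\}$, both executable only if $p\in W$; - $+r_p$: $R'=R\cup\{p\}$; $-r_p$: $R'=R\setminus\{p\}$, $W'=W\setminus\{p\}$; $+w_p$: $R'=R\cup\{p\}$, $W'=W\cup\{p\}$; $-w_p$: $W'=W\setminus\{p\}$; - $\varphi?$: $m'=m$ and $m\models\varphi$; $\varphi??$: $m'=m$ and $m''\models\varphi$ for all $m''\sim m$; - $;$, $\cup$, ${}^*$: relational composition, union, reflexive transitive closure; - $m\,[\pi_1\|\pi_2]\,m'$ iff there are $m_1,m_2,m_1',m_2'$ with $m\lhd(m_1,m_2)$, $m'\rhd(m_1',m_2')$ and, for $k=1,2$, $m_k\,[\pi_k]\,m_k'$, $R_k=R_k'$, $W_k=W_k'$, $V_k\setminus W_k=V_k'\setminus W_k'$. **The logic DL-PA** over a set of atoms has formulas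 $a\mid\top\mid\neg\varphi\mid\varphi\lor\varphi\mid\langle\pi\rangle\varphi$ and programs ${+a}\mid{-a}\mid\varphi?\mid\pi;\pi\mid\pi\cup\pi\mid\pi^*$; its models are sets $V$ of atoms, assignments are unconditional, and everything else is as above. In both logics a formula is satisfiable iff it is true in some model. Other connectives and $[\pi]\varphi=\neg\langle\pi\rangle\neg\varphi$ are the usual abbreviations, an empty conjunction is $\top$, and $a\leftarrow\varphi$ abbreviates $(\varphi?;+a)\cup(\neg\varphi?;-a)$. **The translation.** For every occurrence of $\|$, every $p$ and $k\in\{1,2\}$ there are fresh variables $p^k,\ p^{k,r},\ p^{k,w}$. The atoms of the target language are the variables $x\in\mathbb P$, the fresh variables, and for each such variable $x$ two more atoms $R(x)$, $W(x)$. The map $t$ commutes with all constructs other than the following: - $t(+p)=W(p)?;+p$ and $t(-p)=W(p)?;-p$; - $t(+r_p)=+R(p)$, $t(-r_p)=-W(p);-R(p)$, $t(+w_p)=+R(p);+W(p)$, $t(-w_p)=-W(p)$; - $t(\varphi??)=\Big(\big[\,;_{p\in\mathbb P(\varphi)}\big(R(p)?\cup(\neg R(p)?;(+p\cup -p))\big)\big]\,t(\varphi)\Big)?$;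 - $t(\pi_1\|\pi_2)=\mathrm{split};\mathrm{store};t(\pi_1^1);t(\pi_2^2);\mathrm{ok}?;\mathrm{merge}$, where $\pi_k^k$ is $\pi_k$ with each $p$ replaced by $p^k$, and with $P=\mathbb P(\pi_1\|\pi_2)$: split is the sequence over $p\in P$ of $\big((p?;+p^1;+p^2)\cup(\neg p?;-p^1;-p^2)\big);\ -W(p^1);-R(p^1);-W(p^2);-R(p^2);$ $\Big(\neg R(p)?\ \cup\ \big(W(p)?;((+R(p^1);+W(p^1))\cup(+R(p^2);+W(p^2)))\big)\ \cup\ \big((\neg W(p)\land R(p))?;(+R(p^1)\cup +R(p^2)\cup(+R(p^1);+R(p^2)))\big)\Big)$; store is the sequence over $p\in P$, $k\in\{1,2\}$ of $(p^{k,r}\leftarrow R(p^k));(p^{k,w}\leftarrow W(p^k))$; ok is $\bigwedge_{p\in P}\bigwedge_{k\in\{1,2\}}\big((p^{k,r}\leftrightarrow R(p^k))\land(p^{k,w}\leftrightarrow W(p^k))\land(\neg p^{k,w}\to(p\leftrightarrow p^k))\big)$; merge is the sequence over $p\in P$ of $\Big(\neg W(p)?\ \cup\ \big(((W(p^1)\land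 p^1)\lor(W(p^2)\land p^2))?;+p\big)\ \cup\ \big(((W(p^1)\land\neg p^1)\lor(W(p^2)\land\neg p^2))?;-p\big)\Big)$ followed, for $k=1,2$, by $-p^{k,r};-p^{k,w};-p^k;-W(p^k);-R(p^k)$. **Theorem.** A DL-PA$^\|$ formula $\varphi$ is DL-PA$^\|$-satisfiable if and only if the DL-PA formula $$t(\varphi)\land\bigwedge_{p\in\mathbb P(\varphi)}\big(W(p)\to R(p)\big)$$ is DL-PA-satisfiable. Moreover $t$ is a polynomial-size translation: there is a polynomial $f$ such that the sizes (numbers of symbols) of $t(\varphi)$ and of the displayed formula are at most $f(|\varphi|)$ for every formula $\varphi$, and that of $t(\pi)$ is at most $f(|\pi|)$ for every program $\pi$. -/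

import Mathlib

universe u

namespace DLPAPar

/-! The logic DL-PA with parallel composition over a type `V` of propositional variables. -/

mutual
/-- Formulas. -/
inductive Formula (V : Type u) : Type u
  | var (p : V) : Formula V
  | top : Formula V
  | neg (φ : Formula V) : Formula V
  | or (φ ψ : Formula V) : Formula V
  | dia (π : Program V) (φ : Formula V) : Formula V

/-- Programs: the six assignments to the truth value (`V`), to the readability (`R`) and to the
writability (`W`) of a variable, exogenous (PDL) tests, endogenous tests, sequential composition,
nondeterministic choice, iteration and parallel composition. -/
inductive Program (V : Type u) : Type u
  | setV (p : V) : Program V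
  | unsetV (p : V) : Program V
  | setR (p : V) : Program V
  | unsetR (p : V) : Program V
  | setW (p : V) : Program V
  | unsetW (p : V) : Program V
  | test (φ : Formula V) : Program V
  | endoTest (φ : Formula V) : Program V
  | seq (π ρ : Program V) : Program V
  | choice (π ρ : Program V) : Program V
  | star (π : Program V) : Program V
  | par (π ρ : Program V) : Program V
end

/-- A model: readable variables, writable variables and a valuation; writable variables are
readable. -/
@[ext]
structure Model (V : Type u) where
  /-- the readable variables -/
  R : Set V
  /-- the writable variables -/
  W : Set V
  /-- the true variables -/
  val : Set V
  writable_readable : W ⊆ R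

variable {V : Type u}

/-- RW-disjointness. -/
def Model.RWDisjoint (M₁ M₂ : Model V) : Prop :=
  M₁.W ∩ M₂.R = ∅ ∧ M₂.W ∩ M₁.R = ∅

/-- `M` can be split into `M₁` and `M₂`. -/
def Model.Split (M M₁ M₂ : Model V) : Prop :=
  M₁.RWDisjoint M₂ ∧ M.R = M₁.R ∪ M₂.R ∧ M.W = M₁.W ∪ M₂.W ∧
    M.val = M₁.val ∧ M.val = M₂.val

/-- `M` is the merge of `M₁` and `M₂`. -/
def Model.Merge (M M₁ M₂ : Model V) : Prop :=
  M₁.RWDisjoint M₂ ∧ M.R = M₁.R ∪ M₂.R ∧ M.W = M₁.W ∪ M₂.W ∧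
    M₁.val \ M.W = M₂.val \ M.W ∧
    M.val = (M₁.val ∩ M₁.W) ∪ (M₂.val ∩ M₂.W) ∪ (M₁.val ∩ M₂.val)

/-- Read-indistinguishability. -/
def Model.Indist (M M' : Model V) : Prop :=
  M.R = M'.R ∧ M.W = M'.W ∧ M.val ∩ M.R = M'.val ∩ M'.R

/-- The legal moves of a component of a parallel composition: readability, writability and the
values of the non-writable variables stay the same. -/
def Model.Legal (M M' : Model V) : Prop :=
  M.R = M'.R ∧ M.W = M'.W ∧ M.val \ M.W = M'.val \ M'.W

mutual
/-- Truth of a formula in a model. -/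
def Formula.Sat : Formula V → Model V → Prop
  | .var p, M => p ∈ M.val
  | .top, _ => True
  | .neg φ, M => ¬ φ.Sat M
  | .or φ ψ, M => φ.Sat M ∨ ψ.Sat M
  | .dia π φ, M => ∃ M', π.Run M M' ∧ φ.Sat M'

/-- The relation on models that interprets a program. -/
def Program.Run : Program V → Model V → Model V → Prop
  | .setV p, M, M' => M'.R = M.R ∧ M'.W = M.W ∧ M'.val = M.val ∪ {p} ∧ p ∈ M.W
  | .unsetV p, M, M' => M'.R = M.R ∧ M'.W = M.W ∧ M'.val = M.val \ {p} ∧ p ∈ M.W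
  | .setR p, M, M' => M'.R = M.R ∪ {p} ∧ M'.W = M.W ∧ M'.val = M.val
  | .unsetR p, M, M' => M'.R = M.R \ {p} ∧ M'.W = M.W \ {p} ∧ M'.val = M.val
  | .setW p, M, M' => M'.R = M.R ∪ {p} ∧ M'.W = M.W ∪ {p} ∧ M'.val = M.val
  | .unsetW p, M, M' => M'.R = M.R ∧ M'.W = M.W \ {p} ∧ M'.val = M.val
  | .test φ, M, M' => M = M' ∧ φ.Sat M
  | .endoTest φ, M, M' => M = M' ∧ ∀ M'' : Model V, M''.Indist M → φ.Sat M''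
  | .seq π ρ, M, M' => ∃ M'', π.Run M M'' ∧ ρ.Run M'' M'
  | .choice π ρ, M, M' => π.Run M M' ∨ ρ.Run M M'
  | .star π, M, M' => Relation.ReflTransGen π.Run M M'
  | .par π ρ, M, M' => ∃ M₁ M₂ M₁' M₂' : Model V,
      M.Split M₁ M₂ ∧ M'.Merge M₁' M₂' ∧
      π.Run M₁ M₁' ∧ M₁.Legal M₁' ∧ ρ.Run M₂ M₂' ∧ M₂.Legal M₂'
end

/-- Satisfiability. -/
def Formula.Satisfiable (φ : Formula V) : Prop := ∃ M : Model V, φ.Sat M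

mutual
/-- The propositional variables that occur in a formula, without repetitions. -/
def Formula.vars [DecidableEq V] : Formula V → List V
  | .var p => [p]
  | .top => []
  | .neg φ => φ.vars
  | .or φ ψ => φ.vars ∪ ψ.vars
  | .dia π φ => π.vars ∪ φ.vars

/-- The propositional variables that occur in a program, without repetitions. -/
def Program.vars [DecidableEq V] : Program V → List V
  | .setV p => [p]
  | .unsetV p => [p]
  | .setR p => [p]
  | .unsetR p => [p]
  | .setW p => [p]
  | .unsetW p => [p]
  | .test φ => φ.vars
  | .endoTest φ => φ.vars
  | .seq π ρ => π.vars ∪ ρ.vars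
  | .choice π ρ => π.vars ∪ ρ.vars
  | .star π => π.vars
  | .par π ρ => π.vars ∪ ρ.vars
end

mutual
/-- The number of symbols of a formula. -/
def Formula.size : Formula V → ℕ
  | .var _ => 1
  | .top => 1
  | .neg φ => φ.size + 1
  | .or φ ψ => φ.size + ψ.size + 1
  | .dia π φ => π.size + φ.size + 1

/-- The number of symbols of a program (an assignment counts as an operator and a variable). -/
def Program.size : Program V → ℕ
  | .setV _ => 2
  | .unsetV _ => 2
  | .setR _ => 2
  | .unsetR _ => 2
  | .setW _ => 2
  | .unsetW _ => 2
  | .test φ => φ.size + 1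
  | .endoTest φ => φ.size + 1
  | .seq π ρ => π.size + ρ.size + 1
  | .choice π ρ => π.size + ρ.size + 1
  | .star π => π.size + 1
  | .par π ρ => π.size + ρ.size + 1
end

/-! DL-PA over a type `A` of atoms. -/

mutual
/-- Formulas of DL-PA. -/
inductive DFormula (A : Type u) : Type u
  | atom (a : A) : DFormula A
  | top : DFormula A
  | neg (φ : DFormula A) : DFormula A
  | or (φ ψ : DFormula A) : DFormula A
  | dia (π : DProgram A) (φ : DFormula A) : DFormula A

/-- Programs of DL-PA. -/
inductive DProgram (A : Type u) : Type u
  | set (a : A) : DProgram A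
  | unset (a : A) : DProgram A
  | test (φ : DFormula A) : DProgram A
  | seq (π ρ : DProgram A) : DProgram A
  | choice (π ρ : DProgram A) : DProgram A
  | star (π : DProgram A) : DProgram A
end

variable {A : Type u}

mutual
/-- Truth of a DL-PA formula in a valuation, i.e. a set of atoms. -/
def DFormula.Sat : DFormula A → Set A → Prop
  | .atom a, v => a ∈ v
  | .top, _ => True
  | .neg φ, v => ¬ φ.Sat v
  | .or φ ψ, v => φ.Sat v ∨ ψ.Sat v
  | .dia π φ, v => ∃ v', π.Run v v' ∧ φ.Sat v'

/-- The relation on valuations that interprets a DL-PA program; assignments are unconditional. -/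
def DProgram.Run : DProgram A → Set A → Set A → Prop
  | .set a, v, v' => v' = v ∪ {a}
  | .unset a, v, v' => v' = v \ {a}
  | .test φ, v, v' => v = v' ∧ φ.Sat v
  | .seq π ρ, v, v' => ∃ v'', π.Run v v'' ∧ ρ.Run v'' v'
  | .choice π ρ, v, v' => π.Run v v' ∨ ρ.Run v v'
  | .star π, v, v' => Relation.ReflTransGen π.Run v v'
end

/-- DL-PA satisfiability. -/
def DFormula.Satisfiable (φ : DFormula A) : Prop := ∃ v : Set A, φ.Sat v

mutual
/-- The number of symbols of a DL-PA formula in which an atom `a` is written with `w a`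
symbols. -/
def DFormula.size (w : A → ℕ) : DFormula A → ℕ
  | .atom a => w a
  | .top => 1
  | .neg φ => φ.size w + 1
  | .or φ ψ => φ.size w + ψ.size w + 1
  | .dia π φ => π.size w + φ.size w + 1

/-- The number of symbols of a DL-PA program in which an atom `a` is written with `w a`
symbols. -/
def DProgram.size (w : A → ℕ) : DProgram A → ℕ
  | .set a => w a + 1
  | .unset a => w a + 1
  | .test φ => φ.size w + 1
  | .seq π ρ => π.size w + ρ.size w + 1
  | .choice π ρ => π.size w + ρ.size w + 1
  | .star π => π.size w + 1
end

namespace DFormula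

/-- Conjunction, as an abbreviation. -/
def and (φ ψ : DFormula A) : DFormula A := neg (or (neg φ) (neg ψ))

/-- Implication, as an abbreviation. -/
def imp (φ ψ : DFormula A) : DFormula A := or (neg φ) ψ

/-- Equivalence, as an abbreviation. -/
def iff (φ ψ : DFormula A) : DFormula A := and (imp φ ψ) (imp ψ φ)

/-- The dual of `dia`. -/
def box (π : DProgram A) (φ : DFormula A) : DFormula A := neg (dia π (neg φ))

/-- The conjunction of the `f x`, for `x` in a list; it is `⊤` for the empty list. -/
def bigAnd {X : Type u} (l : List X) (f : X → DFormula A) : DFormula A :=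
  l.foldr (fun x φ => and (f x) φ) top

end DFormula

namespace DProgram

/-- The program `⊤?`. -/
def skip : DProgram A := test .top

/-- The sequential composition of the `f x`, for `x` in a list; it is `⊤?` for the empty list. -/
def bigSeq {X : Type u} (l : List X) (f : X → DProgram A) : DProgram A :=
  l.foldr (fun x π => seq (f x) π) skip

/-- The assignment of the truth value of `φ` to `a`. -/
def assign (a : A) (φ : DFormula A) : DProgram A :=
  choice (seq (test φ) (set a)) (seq (test (.neg φ)) (unset a))

end DProgram

/-! The translation. -/

/-- The two components of a parallel composition. -/
inductive Side : Type
  | one : Side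
  | two : Side

/-- The original variables and their fresh copies. The copies are indexed by an occurrence `o` of
the parallel composition operator (given by its address in the syntax tree) and by a component `k`
of it: `copy o k p` is the copy of `p` on which that component works, and `copyR o k p`,
`copyW o k p` store whether this copy is readable, writable just after the split. -/
inductive PVar (V : Type u) : Type u
  | orig (p : V) : PVar V
  | copy (o : List Bool) (k : Side) (p : V) : PVar V
  | copyR (o : List Bool) (k : Side) (p : V) : PVar V
  | copyW (o : List Bool) (k : Side) (p : V) : PVar V

/-- The atoms of the target language: every propositional variable `x` comes with two further
propositional variables `R x` and `W x`. -/
inductive Atm (X : Type u) : Type u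
  | var (x : X) : Atm X
  | R (x : X) : Atm X
  | W (x : X) : Atm X

/-- The number of symbols of the name of a variable, addresses included. -/
def PVar.size : PVar V → ℕ
  | .orig _ => 1
  | .copy o _ _ => o.length + 3
  | .copyR o _ _ => o.length + 3
  | .copyW o _ _ => o.length + 3

/-- The number of symbols of the name of an atom. -/
def Atm.size : Atm (PVar V) → ℕ
  | .var x => x.size
  | .R x => x.size + 1
  | .W x => x.size + 1

/-- Formulas of the target language. -/
abbrev TFormula (V : Type u) : Type u := DFormula (Atm (PVar V))

/-- Programs of the target language. -/
abbrev TProgram (V : Type u) : Type u := DProgram (Atm (PVar V))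

/-- A variable as a formula. -/
def fv (x : PVar V) : TFormula V := .atom (.var x)

/-- The formula `R x`. -/
def fR (x : PVar V) : TFormula V := .atom (.R x)

/-- The formula `W x`. -/
def fW (x : PVar V) : TFormula V := .atom (.W x)

open DFormula DProgram in
/-- The program that simulates a split. In this and the following four definitions, `o` is the
occurrence of the parallel composition operator that is being translated, `P` lists its variables,
and `σ p` is what stands for `p` where the operator occurs. -/
def split (o : List Bool) (σ : V → PVar V) (P : List V) : TProgram V :=
  bigSeq P fun p =>
    let p₁ := PVar.copy o .one p
    let p₂ := PVar.copy o .two p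
    seq
      (choice
        (seq (test (fv (σ p))) (seq (set (.var p₁)) (set (.var p₂))))
        (seq (test (neg (fv (σ p)))) (seq (unset (.var p₁)) (unset (.var p₂)))))
      (seq
        (seq (unset (.W p₁)) (seq (unset (.R p₁)) (seq (unset (.W p₂)) (unset (.R p₂)))))
        (choice
          (test (neg (fR (σ p))))
          (choice
            (seq (test (fW (σ p)))
              (choice (seq (set (.R p₁)) (set (.W p₁))) (seq (set (.R p₂)) (set (.W p₂)))))
            (seq (test (and (neg (fW (σ p))) (fR (σ p))))
              (choice (set (.R p₁)) (choice (set (.R p₂)) (seq (set (.R p₁)) (set (.R p₂)))))))))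

open DFormula DProgram in
/-- The program that stores which copies are readable and writable after the split. -/
def store (o : List Bool) (P : List V) : TProgram V :=
  bigSeq P fun p =>
    let body (k : Side) : TProgram V :=
      seq (assign (.var (.copyR o k p)) (fR (.copy o k p)))
        (assign (.var (.copyW o k p)) (fW (.copy o k p)))
    seq (body .one) (body .two)

open DFormula in
/-- The formula that says that both components have only made legal changes. -/
def okChange (o : List Bool) (σ : V → PVar V) (P : List V) : TFormula V :=
  bigAnd P fun p =>
    let body (k : Side) : TFormula V :=
      and (iff (fv (.copyR o k p)) (fR (.copy o k p)))
        (and (iff (fv (.copyW o k p)) (fW (.copy o k p)))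
          (imp (neg (fv (.copyW o k p))) (iff (fv (σ p)) (fv (.copy o k p)))))
    and (body .one) (body .two)

open DFormula DProgram in
/-- The program that simulates a merge and then resets the copies. -/
def merge (o : List Bool) (σ : V → PVar V) (P : List V) : TProgram V :=
  bigSeq P fun p =>
    let p₁ := PVar.copy o .one p
    let p₂ := PVar.copy o .two p
    let reset (k : Side) : TProgram V :=
      seq (unset (.var (.copyR o k p))) (seq (unset (.var (.copyW o k p)))
        (seq (unset (.var (.copy o k p)))
          (seq (unset (.W (.copy o k p))) (unset (.R (.copy o k p))))))
    seq
      (choice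
        (test (neg (fW (σ p))))
        (choice
          (seq (test (or (and (fW p₁) (fv p₁)) (and (fW p₂) (fv p₂)))) (set (.var (σ p))))
          (seq (test (or (and (fW p₁) (neg (fv p₁))) (and (fW p₂) (neg (fv p₂)))))
            (unset (.var (σ p))))))
      (seq (reset .one) (reset .two))

open DFormula DProgram in
/-- The sequentialisation of a parallel composition: `τ₁` and `τ₂` are the translations of its two
components, read on the copies. -/
def flatten (o : List Bool) (σ : V → PVar V) (P : List V) (τ₁ τ₂ : TProgram V) : TProgram V :=
  seq (split o σ P) (seq (store o P) (seq τ₁ (seq τ₂ (seq (test (okChange o σ P)) (merge o σ P)))))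

open DFormula DProgram in
/-- The program that gives arbitrary values to the unreadable variables of `P`. -/
def vary (σ : V → PVar V) (P : List V) : TProgram V :=
  bigSeq P fun p =>
    choice (test (fR (σ p)))
      (seq (test (neg (fR (σ p)))) (choice (set (.var (σ p))) (unset (.var (σ p)))))

mutual
/-- The translation of the formula that is obtained from the given one by the renaming `σ` of
variables; `o` is the address of the formula in the syntax tree. -/
def Formula.transAt [DecidableEq V] :
    Formula V → (o : List Bool) → (σ : V → PVar V) → TFormula V
  | .var p, _, σ => fv (σ p)
  | .top, _, _ => .top
  | .neg φ, o, σ => .neg (φ.transAt (false :: o) σ)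
  | .or φ ψ, o, σ => .or (φ.transAt (false :: o) σ) (ψ.transAt (true :: o) σ)
  | .dia π φ, o, σ => .dia (π.transAt (false :: o) σ) (φ.transAt (true :: o) σ)

/-- The translation of the program that is obtained from the given one by the renaming `σ` of
variables; `o` is the address of the program in the syntax tree. -/
def Program.transAt [DecidableEq V] :
    Program V → (o : List Bool) → (σ : V → PVar V) → TProgram V
  | .setV p, _, σ => .seq (.test (fW (σ p))) (.set (.var (σ p)))
  | .unsetV p, _, σ => .seq (.test (fW (σ p))) (.unset (.var (σ p)))
  | .setR p, _, σ => .set (.R (σ p))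
  | .unsetR p, _, σ => .seq (.unset (.W (σ p))) (.unset (.R (σ p)))
  | .setW p, _, σ => .seq (.set (.R (σ p))) (.set (.W (σ p)))
  | .unsetW p, _, σ => .unset (.W (σ p))
  | .test φ, o, σ => .test (φ.transAt (false :: o) σ)
  | .endoTest φ, o, σ => .test (.box (vary σ φ.vars) (φ.transAt (false :: o) σ))
  | .seq π ρ, o, σ => .seq (π.transAt (false :: o) σ) (ρ.transAt (true :: o) σ)
  | .choice π ρ, o, σ => .choice (π.transAt (false :: o) σ) (ρ.transAt (true :: o) σ)
  | .star π, o, σ => .star (π.transAt (false :: o) σ)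
  | .par π ρ, o, σ => flatten o σ (π.vars ∪ ρ.vars)
      (π.transAt (false :: o) (PVar.copy o .one)) (ρ.transAt (true :: o) (PVar.copy o .two))
end

/-- The translation `t` of formulas. -/
def Formula.trans [DecidableEq V] (φ : Formula V) : TFormula V := φ.transAt [] PVar.orig

/-- The translation `t` of programs. -/
def Program.trans [DecidableEq V] (π : Program V) : TProgram V := π.transAt [] PVar.orig

/-- The conjunction of the formulas `W p → R p`, for the variables `p` in `P`. -/
def inclusion (P : List V) : TFormula V :=
  DFormula.bigAnd P fun p => DFormula.imp (fW (.orig p)) (fR (.orig p))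

end DLPAPar

-- A valuation of the target language encodes a model through its atoms `x`, `R x`, `W x`. The
-- relation `Agree σ S M v` says that `v`, read through the renaming `σ`, describes `M` on the
-- variables in `S`. The core of the proof is that agreement is a bisimulation: whenever `M` and `v`
-- agree, each run of `π` from `M` is matched by a run of its translation from `v` ending in
-- agreement, and conversely (`Simulates`). This is proved together with the invariance of truth, by
-- induction on syntax (`Formula.sat_transAt`, `Program.simulates_transAt`). Taking `S` to be
-- exactly the variables of a formula shows at once that its truth depends on nothing else, which is
-- what endogenous tests need.
--
-- The substantial case is `Simulates.par`. Splitting, storing and merging are loops over variables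
-- whose bodies touch pairwise disjoint sets of atoms, so each loop can be analysed one variable at
-- a time (`bigSeq_progress`, `bigSeq_sound`), where only propositional reasoning remains. The two
-- components may be run one after the other because each writes only its own copies and the fresh
-- variables of operators nested inside it (`WritesCopies`). Hence the first run disturbs neither
-- the copies of the second component, nor the stored flags, nor the original variables. The test
-- between the runs and the merge then amounts to the two legality conditions (`sat_okChange_iff`).
-- Variables that do not occur in the parallel composition are handled by frame properties on both
-- sides (`Program.Run.sameAt`, `Run.mem_iff`).
--
-- For satisfiability, a model yields a valuation directly, and a valuation satisfying the
-- inclusions yields a model after its permissions are restricted to the variables of the formula.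
-- For the size bound, every subexpression is translated only once, and each symbol costs at most
-- quadratically many symbols in a bound `B` on name lengths and numbers of variables.

namespace DLPAPar

variable {A : Type u}

-- Frame property of DL-PA programs, and sequences of programs with disjoint domains

namespace DProgram

/-- The atoms that a program may assign. -/
def writes : DProgram A → Set A
  | .set a => {a}
  | .unset a => {a}
  | .test _ => ∅
  | .seq π ρ => π.writes ∪ ρ.writes
  | .choice π ρ => π.writes ∪ ρ.writes
  | .star π => π.writes

/-- Assignments are the only source of change. This frame principle is behind every later claim that
one program does not interfere with another. -/
theorem Run.mem_iff : ∀ (π : DProgram A) {v v' : Set A}, π.Run v v' →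
    ∀ a ∉ π.writes, (a ∈ v' ↔ a ∈ v)
  | .set b, v, v', h, a, ha => by
      simp only [Run, writes, Set.mem_singleton_iff] at h ha
      simp [h, ha]
  | .unset b, v, v', h, a, ha => by
      simp only [Run, writes, Set.mem_singleton_iff] at h ha
      simp [h, ha]
  | .test _, v, v', h, a, _ => by
      simp only [Run] at h
      rw [h.1]
  | .seq π ρ, v, v', h, a, ha => by
      simp only [Run, writes, Set.mem_union, not_or] at h ha
      obtain ⟨v'', h₁, h₂⟩ := h
      exact (mem_iff ρ h₂ a ha.2).trans (mem_iff π h₁ a ha.1)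
  | .choice π ρ, v, v', h, a, ha => by
      simp only [Run, writes, Set.mem_union, not_or] at h ha
      rcases h with h | h
      · exact mem_iff π h a ha.1
      · exact mem_iff ρ h a ha.2
  | .star π, v, v', h, a, ha => by
      simp only [Run, writes] at h ha
      induction h with
      | refl => rfl
      | tail _ h ih => exact (mem_iff π h a ha).trans ih

theorem mem_writes_bigSeq {X : Type u} {l : List X} {f : X → DProgram A} {a : A} :
    a ∈ (bigSeq l f).writes ↔ ∃ x ∈ l, a ∈ (f x).writes := by
  induction l with
  | nil => simp [bigSeq, skip, writes]
  | cons x l ih =>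
    simp only [bigSeq, List.foldr_cons, writes, Set.mem_union] at ih ⊢
    simp [ih]

section BigSeq

variable {X : Type u} {f : X → DProgram A} {D : X → Set A} {T : X → Set A → Prop}

/-- If the program of each `x` works on its own domain `D x`, and there can establish the local
property `T x`, then their sequence can establish all these properties. -/
theorem bigSeq_progress {l : List X} {v : Set A} (hw : ∀ x ∈ l, (f x).writes ⊆ D x)
    (hd : l.Pairwise fun x y => Disjoint (D x) (D y))
    (hT : ∀ x ∈ l, ∀ u u' : Set A, (∀ a ∈ D x, (a ∈ u ↔ a ∈ u')) → T x u → T x u')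
    (hf : ∀ x ∈ l, ∀ u : Set A, (∀ a ∈ D x, (a ∈ u ↔ a ∈ v)) → ∃ u', (f x).Run u u' ∧ T x u') :
    ∃ v', (bigSeq l f).Run v v' ∧ ∀ x ∈ l, T x v' := by
  induction l generalizing v with
  | nil => exact ⟨v, by simp [bigSeq, skip, Run, DFormula.Sat], by simp⟩
  | cons x l ih =>
    rw [List.pairwise_cons] at hd
    obtain ⟨u, hu, hTu⟩ := hf x (by simp) v fun _ _ => Iff.rfl
    -- The rest of the sequence starts from `u` instead of `v`. The program of `x` wrote only inside
    -- `D x`, so `u` and `v` still coincide on every later domain.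
    obtain ⟨v', hv', hTv'⟩ := ih (v := u) (fun y hy => hw y (by simp [hy])) hd.2
      (fun y hy => hT y (by simp [hy])) fun y hy w hwu => hf y (by simp [hy]) w fun a ha =>
        (hwu a ha).trans (hu.mem_iff _ a fun hax =>
          Set.disjoint_left.1 (hd.1 y hy) (hw x (by simp) hax) ha)
    refine ⟨v', ⟨u, hu, hv'⟩, fun y hy => ?_⟩
    rcases List.mem_cons.1 hy with rfl | hy
    -- The later programs write outside the domain of the head, so its local property survives up to
    -- `v'`.
    · refine hT y (by simp) u v' (fun a ha => (hv'.mem_iff _ a fun haw => ?_).symm) hTu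
      obtain ⟨z, hz, haz⟩ := mem_writes_bigSeq.1 haw
      exact Set.disjoint_left.1 (hd.1 z hz) ha (hw z (by simp [hz]) haz)
    · exact hTv' y hy

/-- If the program of each `x` works on its own domain `D x`, and there always establishes the
local property `T x`, then their sequence establishes all these properties. -/
theorem bigSeq_sound {l : List X} {v v' : Set A} (hw : ∀ x ∈ l, (f x).writes ⊆ D x)
    (hd : l.Pairwise fun x y => Disjoint (D x) (D y))
    (hT : ∀ x ∈ l, ∀ u u' : Set A, (∀ a ∈ D x, (a ∈ u ↔ a ∈ u')) → T x u → T x u')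
    (hf : ∀ x ∈ l, ∀ u u' : Set A, (∀ a ∈ D x, (a ∈ u ↔ a ∈ v)) → (f x).Run u u' → T x u')
    (h : (bigSeq l f).Run v v') : ∀ x ∈ l, T x v' := by
  induction l generalizing v with
  | nil => simp
  | cons x l ih =>
    rw [List.pairwise_cons] at hd
    obtain ⟨u, hu, hv'⟩ : ∃ u, (f x).Run v u ∧ (bigSeq l f).Run u v' := h
    intro y hy
    rcases List.mem_cons.1 hy with rfl | hy
    · refine hT y (by simp) u v' (fun a ha => (hv'.mem_iff _ a fun haw => ?_).symm)
        (hf y (by simp) v u (fun _ _ => Iff.rfl) hu)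
      obtain ⟨z, hz, haz⟩ := mem_writes_bigSeq.1 haw
      exact Set.disjoint_left.1 (hd.1 z hz) ha (hw z (by simp [hz]) haz)
    · exact ih (v := u) (fun y hy => hw y (by simp [hy])) hd.2
        (fun y hy => hT y (by simp [hy])) (fun y hy w w' hwu => hf y (by simp [hy]) w w' fun a ha =>
          (hwu a ha).trans (hu.mem_iff _ a fun hax =>
            Set.disjoint_left.1 (hd.1 y hy) (hw x (by simp) hax) ha)) hv' y hy

end BigSeq

/-- Exactly one of the two guards holds, so the assignment is total and deterministic; in this form
the intermediate valuations can be eliminated by substitution. -/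
theorem run_assign {a : A} {φ : DFormula A} {v v' : Set A} :
    (assign a φ).Run v v' ↔ v' = {b | (b = a ∧ φ.Sat v) ∨ (b ≠ a ∧ b ∈ v)} := by
  by_cases h : φ.Sat v
  · have : v ∪ {a} = {b | (b = a ∧ φ.Sat v) ∨ (b ≠ a ∧ b ∈ v)} := by
      ext b; by_cases hb : b = a <;> simp [h, hb]
    rw [← this]
    simp [assign, Run, DFormula.Sat, h]
  · have : v \ {a} = {b | (b = a ∧ φ.Sat v) ∨ (b ≠ a ∧ b ∈ v)} := by
      ext b; by_cases hb : b = a <;> simp [h, hb]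
    rw [← this]
    simp [assign, Run, DFormula.Sat, h]

end DProgram

-- Truth of the abbreviated connectives

namespace DFormula

variable {φ ψ : DFormula A} {v : Set A}

@[simp] theorem sat_neg : (neg φ).Sat v ↔ ¬ φ.Sat v := by simp [Sat]

@[simp] theorem sat_or : (or φ ψ).Sat v ↔ φ.Sat v ∨ ψ.Sat v := by simp [Sat]

@[simp] theorem sat_and : (and φ ψ).Sat v ↔ φ.Sat v ∧ ψ.Sat v := by simp [and, Sat]

@[simp] theorem sat_imp : (imp φ ψ).Sat v ↔ (φ.Sat v → ψ.Sat v) := by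
  simp [imp, Sat, imp_iff_not_or]

@[simp] theorem sat_iff : (iff φ ψ).Sat v ↔ (φ.Sat v ↔ ψ.Sat v) := by
  simp [iff, iff_def]

@[simp] theorem sat_box {π : DProgram A} :
    (box π φ).Sat v ↔ ∀ v', π.Run v v' → φ.Sat v' := by
  simp [box, Sat]

@[simp] theorem sat_bigAnd {X : Type u} {l : List X} {f : X → DFormula A} :
    (bigAnd l f).Sat v ↔ ∀ x ∈ l, (f x).Sat v := by
  induction l with
  | nil => simp [bigAnd, Sat]
  | cons x l ih =>
    have : bigAnd (x :: l) f = and (f x) (bigAnd l f) := rfl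
    simp [this, ih]

end DFormula

variable {V : Type u}

@[simp] theorem sat_fv {x : PVar V} {v : Set (Atm (PVar V))} :
    (fv x).Sat v ↔ Atm.var x ∈ v := by simp [fv, DFormula.Sat]

@[simp] theorem sat_fR {x : PVar V} {v : Set (Atm (PVar V))} :
    (fR x).Sat v ↔ Atm.R x ∈ v := by simp [fR, DFormula.Sat]

@[simp] theorem sat_fW {x : PVar V} {v : Set (Atm (PVar V))} :
    (fW x).Sat v ↔ Atm.W x ∈ v := by simp [fW, DFormula.Sat]

-- Addresses and freshness of the copies

/-- The variable that an atom is about. -/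
def Atm.base {X : Type u} : Atm X → X
  | .var x => x
  | .R x => x
  | .W x => x

/-- The copies made for the occurrence `o` of the parallel composition, or for one nested in it. -/
def PVar.Under (o : List Bool) : PVar V → Prop
  | .orig _ => False
  | .copy o' _ _ => o <:+ o'
  | .copyR o' _ _ => o <:+ o'
  | .copyW o' _ _ => o <:+ o'

theorem PVar.Under.of_cons {b : Bool} {o : List Bool} : ∀ {x : PVar V}, x.Under (b :: o) →
    x.Under o
  | .orig _, h => h
  | .copy _ _ _, h => (List.suffix_cons b o).trans h
  | .copyR _ _ _, h => (List.suffix_cons b o).trans h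
  | .copyW _ _ _, h => (List.suffix_cons b o).trans h

theorem not_cons_suffix (b : Bool) (o : List Bool) : ¬ (b :: o) <:+ o := fun h => by
  simpa using h.length_le

/-- A renaming that can stand at the address `o`: it is injective and avoids the variables that
are fresh for the operators at or below `o`. -/
structure Outside (o : List Bool) (σ : V → PVar V) : Prop where
  inj : Function.Injective σ
  not_under : ∀ p, ¬ (σ p).Under o

theorem Outside.cons {o : List Bool} {σ : V → PVar V} (h : Outside o σ) (b : Bool) :
    Outside (b :: o) σ :=
  ⟨h.inj, fun p hp => h.not_under p hp.of_cons⟩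

theorem outside_orig (o : List Bool) : Outside o (PVar.orig (V := V)) :=
  ⟨fun _ _ h => by simpa using h, fun _ h => h⟩

/-- Addresses grow at the head, so an operator strictly below `o` has a longer address and its fresh
variables differ from those of `o`. The copies made at `o` can therefore serve as the renaming for
both components. -/
theorem outside_copy (b : Bool) (o : List Bool) (k : Side) :
    Outside (b :: o) (PVar.copy (V := V) o k) :=
  ⟨fun _ _ h => by simpa using h, fun _ h => not_cons_suffix b o h⟩

theorem Outside.ne_copy {o : List Bool} {σ : V → PVar V} (h : Outside o σ) (p q : V) (k : Side) :
    σ p ≠ .copy o k q := fun e => h.not_under p (by rw [e]; exact List.suffix_rfl)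

theorem Outside.ne_copyR {o : List Bool} {σ : V → PVar V} (h : Outside o σ) (p q : V) (k : Side) :
    σ p ≠ .copyR o k q := fun e => h.not_under p (by rw [e]; exact List.suffix_rfl)

theorem Outside.ne_copyW {o : List Bool} {σ : V → PVar V} (h : Outside o σ) (p q : V) (k : Side) :
    σ p ≠ .copyW o k q := fun e => h.not_under p (by rw [e]; exact List.suffix_rfl)

-- Models, one variable at a time

/-- The models agree on everything about the variable `p`. -/
def Model.SameAt (p : V) (M M' : Model V) : Prop :=
  (p ∈ M.R ↔ p ∈ M'.R) ∧ (p ∈ M.W ↔ p ∈ M'.W) ∧ (p ∈ M.val ↔ p ∈ M'.val)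

theorem Model.SameAt.trans {p : V} {M M' M'' : Model V} (h : M.SameAt p M')
    (h' : M'.SameAt p M'') : M.SameAt p M'' :=
  ⟨h.1.trans h'.1, h.2.1.trans h'.2.1, h.2.2.trans h'.2.2⟩

/-- The set equations are all pointwise; stated at a single variable, they become propositional
constraints that can be compared with a loop body. -/
theorem Model.split_iff {M M₁ M₂ : Model V} : M.Split M₁ M₂ ↔ ∀ p : V,
    ¬ (p ∈ M₁.W ∧ p ∈ M₂.R) ∧ ¬ (p ∈ M₂.W ∧ p ∈ M₁.R) ∧ (p ∈ M.R ↔ p ∈ M₁.R ∨ p ∈ M₂.R) ∧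
      (p ∈ M.W ↔ p ∈ M₁.W ∨ p ∈ M₂.W) ∧ (p ∈ M.val ↔ p ∈ M₁.val) ∧ (p ∈ M.val ↔ p ∈ M₂.val) := by
  simp only [Model.Split, Model.RWDisjoint, Set.ext_iff, Set.mem_inter_iff, Set.mem_union,
    Set.mem_empty_iff_false, iff_false, forall_and, and_assoc]

theorem Model.merge_iff {M M₁ M₂ : Model V} : M.Merge M₁ M₂ ↔ ∀ p : V,
    ¬ (p ∈ M₁.W ∧ p ∈ M₂.R) ∧ ¬ (p ∈ M₂.W ∧ p ∈ M₁.R) ∧ (p ∈ M.R ↔ p ∈ M₁.R ∨ p ∈ M₂.R) ∧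
      (p ∈ M.W ↔ p ∈ M₁.W ∨ p ∈ M₂.W) ∧ (p ∈ M₁.val ∧ p ∉ M.W ↔ p ∈ M₂.val ∧ p ∉ M.W) ∧
      (p ∈ M.val ↔ ((p ∈ M₁.val ∧ p ∈ M₁.W) ∨ (p ∈ M₂.val ∧ p ∈ M₂.W)) ∨
        (p ∈ M₁.val ∧ p ∈ M₂.val)) := by
  simp only [Model.Merge, Model.RWDisjoint, Set.ext_iff, Set.mem_inter_iff, Set.mem_union,
    Set.mem_empty_iff_false, iff_false, forall_and, and_assoc, Set.mem_sdiff]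

theorem Model.legal_iff {M M' : Model V} : M.Legal M' ↔ ∀ p : V,
    (p ∈ M.R ↔ p ∈ M'.R) ∧ (p ∈ M.W ↔ p ∈ M'.W) ∧ (p ∉ M.W → (p ∈ M.val ↔ p ∈ M'.val)) := by
  simp only [Model.Legal, Set.ext_iff, forall_and, Set.mem_sdiff]
  refine and_congr_right fun _ => and_congr_right fun hW => forall_congr' fun p => ?_
  rw [← hW p]
  tauto

theorem Program.Run.sameAt [DecidableEq V] : ∀ (π : Program V) {M M' : Model V}, π.Run M M' →
    ∀ p ∉ π.vars, M.SameAt p M'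
  | .setV q, M, M', h, p, hp => by
      simp only [Program.Run, Program.vars, List.mem_singleton] at h hp
      simp [Model.SameAt, h, hp]
  | .unsetV q, M, M', h, p, hp => by
      simp only [Program.Run, Program.vars, List.mem_singleton] at h hp
      simp [Model.SameAt, h, hp]
  | .setR q, M, M', h, p, hp => by
      simp only [Program.Run, Program.vars, List.mem_singleton] at h hp
      simp [Model.SameAt, h, hp]
  | .unsetR q, M, M', h, p, hp => by
      simp only [Program.Run, Program.vars, List.mem_singleton] at h hp
      simp [Model.SameAt, h, hp]
  | .setW q, M, M', h, p, hp => by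
      simp only [Program.Run, Program.vars, List.mem_singleton] at h hp
      simp [Model.SameAt, h, hp]
  | .unsetW q, M, M', h, p, hp => by
      simp only [Program.Run, Program.vars, List.mem_singleton] at h hp
      simp [Model.SameAt, h, hp]
  | .test φ, M, M', h, p, _ => by
      simp only [Program.Run] at h
      simp [Model.SameAt, h.1]
  | .endoTest φ, M, M', h, p, _ => by
      simp only [Program.Run] at h
      simp [Model.SameAt, h.1]
  | .seq π ρ, M, M', h, p, hp => by
      simp only [Program.Run, Program.vars, List.mem_union_iff, not_or] at h hp
      obtain ⟨M'', h₁, h₂⟩ := h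
      exact (sameAt π h₁ p hp.1).trans (sameAt ρ h₂ p hp.2)
  | .choice π ρ, M, M', h, p, hp => by
      simp only [Program.Run, Program.vars, List.mem_union_iff, not_or] at h hp
      exact h.elim (fun h => sameAt π h p hp.1) fun h => sameAt ρ h p hp.2
  | .star π, M, M', h, p, hp => by
      simp only [Program.Run, Program.vars] at h hp
      induction h with
      | refl => exact ⟨Iff.rfl, Iff.rfl, Iff.rfl⟩
      | tail _ h ih => exact ih.trans (sameAt π h p hp)
  | .par π ρ, M, M', h, p, hp => by
      simp only [Program.Run, Program.vars, List.mem_union_iff, not_or] at h hp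
      obtain ⟨M₁, M₂, M₁', M₂', hs, hm, h₁, -, h₂, -⟩ := h
      have h₁ := sameAt π h₁ p hp.1
      have h₂ := sameAt ρ h₂ p hp.2
      have hs := Model.split_iff.1 hs p
      have hm := Model.merge_iff.1 hm p
      clear hp
      -- Neither component changes anything at `p`, so both still carry the value of `M` there, and
      -- the merge puts the split back together.
      simp only [Model.SameAt] at *
      grind only

-- Agreement of valuations with models, and disjoint domains for the loops

/-- The valuation describes, at the variable `x`, what the model says about the variable `p`. -/
def AgreeAt (x : PVar V) (p : V) (M : Model V) (v : Set (Atm (PVar V))) : Prop :=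
  (p ∈ M.R ↔ Atm.R x ∈ v) ∧ (p ∈ M.W ↔ Atm.W x ∈ v) ∧ (p ∈ M.val ↔ Atm.var x ∈ v)

theorem AgreeAt.congr {x : PVar V} {p : V} {M : Model V} {v v' : Set (Atm (PVar V))}
    (h : ∀ a : Atm (PVar V), a.base = x → (a ∈ v ↔ a ∈ v')) (hv : AgreeAt x p M v) :
    AgreeAt x p M v' :=
  ⟨hv.1.trans (h _ rfl), hv.2.1.trans (h _ rfl), hv.2.2.trans (h _ rfl)⟩

theorem AgreeAt.model {x : PVar V} {p : V} {M M' : Model V} {v : Set (Atm (PVar V))}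
    (h : M.SameAt p M') (hv : AgreeAt x p M v) : AgreeAt x p M' v :=
  ⟨h.1.symm.trans hv.1, h.2.1.symm.trans hv.2.1, h.2.2.symm.trans hv.2.2⟩

/-- The valuation describes, through the renaming `σ`, what the model says about the variables
in `S`. -/
def Agree (σ : V → PVar V) (S : List V) (M : Model V) (v : Set (Atm (PVar V))) : Prop :=
  ∀ p ∈ S, AgreeAt (σ p) p M v

/-- The atoms about `σ p` and about the copies of `p`. -/
def localAtoms (o : List Bool) (σ : V → PVar V) (p : V) : Set (Atm (PVar V)) :=
  {a | a.base = σ p ∨ ∃ k, a.base = .copy o k p ∨ a.base = .copyR o k p ∨ a.base = .copyW o k p}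

theorem disjoint_localAtoms {o : List Bool} {σ : V → PVar V} (h : Outside o σ) {p q : V}
    (hpq : p ≠ q) : Disjoint (localAtoms o σ p) (localAtoms o σ q) := by
  rw [Set.disjoint_left]
  rintro a (ha | ⟨k, ha | ha | ha⟩) (hb | ⟨k', hb | hb | hb⟩) <;> rw [ha] at hb
  · exact hpq (h.inj hb)
  · exact h.ne_copy _ _ _ hb
  · exact h.ne_copyR _ _ _ hb
  · exact h.ne_copyW _ _ _ hb
  all_goals first
    | exact h.ne_copy _ _ _ hb.symm
    | exact h.ne_copyR _ _ _ hb.symm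
    | exact h.ne_copyW _ _ _ hb.symm
    | simp [hpq] at hb

theorem pairwise_localAtoms {o : List Bool} {σ : V → PVar V} (h : Outside o σ) {P : List V}
    (hP : P.Nodup) : P.Pairwise fun p q => Disjoint (localAtoms o σ p) (localAtoms o σ q) :=
  hP.imp fun hpq => disjoint_localAtoms h hpq

-- The loops `split`, `store`, `merge` and `vary`

section Bodies

open DProgram

variable {o : List Bool} {σ : V → PVar V} {P : List V} {v v' : Set (Atm (PVar V))} {M : Model V}

theorem base_of_mem_writes_split {a : Atm (PVar V)} (h : a ∈ (split o σ P).writes) :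
    ∃ p ∈ P, ∃ k, a.base = .copy o k p := by
  obtain ⟨p, hp, h⟩ := mem_writes_bigSeq.1 h
  refine ⟨p, hp, ?_⟩
  simp only [writes, Set.mem_union, Set.mem_singleton_iff, Set.mem_empty_iff_false, false_or] at h
  casesm* _ ∨ _ <;> subst a
  all_goals first | exact ⟨.one, rfl⟩ | exact ⟨.two, rfl⟩

theorem base_of_mem_writes_store {a : Atm (PVar V)} (h : a ∈ (store o P).writes) :
    ∃ p ∈ P, ∃ k, a.base = .copyR o k p ∨ a.base = .copyW o k p := by
  obtain ⟨p, hp, h⟩ := mem_writes_bigSeq.1 h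
  refine ⟨p, hp, ?_⟩
  simp only [assign, writes, Set.mem_union, Set.mem_singleton_iff, Set.mem_empty_iff_false,
    false_or] at h
  casesm* _ ∨ _ <;> subst a
  all_goals first
    | exact ⟨.one, .inl rfl⟩ | exact ⟨.one, .inr rfl⟩
    | exact ⟨.two, .inl rfl⟩ | exact ⟨.two, .inr rfl⟩

theorem base_of_mem_writes_merge {a : Atm (PVar V)} (h : a ∈ (merge o σ P).writes) :
    ∃ p ∈ P, a = .var (σ p) ∨
      ∃ k, a.base = .copy o k p ∨ a.base = .copyR o k p ∨ a.base = .copyW o k p := by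
  obtain ⟨p, hp, h⟩ := mem_writes_bigSeq.1 h
  refine ⟨p, hp, ?_⟩
  simp only [writes, Set.mem_union, Set.mem_singleton_iff, Set.mem_empty_iff_false, false_or] at h
  casesm* _ ∨ _ <;> subst a
  all_goals first
    | exact .inl rfl
    | exact .inr ⟨.one, .inl rfl⟩ | exact .inr ⟨.one, .inr (.inl rfl)⟩
    | exact .inr ⟨.one, .inr (.inr rfl)⟩
    | exact .inr ⟨.two, .inl rfl⟩ | exact .inr ⟨.two, .inr (.inl rfl)⟩
    | exact .inr ⟨.two, .inr (.inr rfl)⟩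

theorem base_of_mem_writes_vary {a : Atm (PVar V)} (h : a ∈ (vary σ P).writes) :
    ∃ p ∈ P, a = .var (σ p) := by
  obtain ⟨p, hp, h⟩ := mem_writes_bigSeq.1 h
  refine ⟨p, hp, ?_⟩
  simpa [writes] using h

theorem split_writes_subset (p : V) : (split o σ [p]).writes ⊆ localAtoms o σ p := fun a ha => by
  obtain ⟨q, hq, k, h⟩ := base_of_mem_writes_split ha
  rw [List.mem_singleton.1 hq] at h
  exact .inr ⟨k, .inl h⟩

theorem store_writes_subset (p : V) : (store o [p]).writes ⊆ localAtoms o σ p := fun a ha => by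
  obtain ⟨q, hq, k, h⟩ := base_of_mem_writes_store ha
  rw [List.mem_singleton.1 hq] at h
  exact .inr ⟨k, .inr h⟩

theorem merge_writes_subset (p : V) : (merge o σ [p]).writes ⊆ localAtoms o σ p := fun a ha => by
  obtain ⟨q, hq, h⟩ := base_of_mem_writes_merge ha
  rw [List.mem_singleton.1 hq] at h
  exact h.imp (fun h => by rw [h]; rfl) id

/-- The atoms about a variable. -/
def baseAtoms (x : PVar V) : Set (Atm (PVar V)) := {a | a.base = x}

theorem vary_writes_subset (p : V) : (vary σ [p]).writes ⊆ baseAtoms (σ p) := fun a ha => by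
  obtain ⟨q, hq, h⟩ := base_of_mem_writes_vary ha
  rw [List.mem_singleton.1 hq] at h
  rw [h]; rfl

/-- At each variable the nondeterministic choices of the body cover all ways of dividing
permissions: a writable variable goes to one side, a merely readable one to either side or to both.
-/
theorem split_progress (hσ : Outside o σ) (hP : P.Nodup) {M₁ M₂ : Model V}
    (hv : Agree σ P M v) (hM : M.Split M₁ M₂) :
    ∃ v', (split o σ P).Run v v' ∧ Agree (.copy o .one) P M₁ v' ∧
      Agree (.copy o .two) P M₂ v' := by
  suffices ∃ v', (split o σ P).Run v v' ∧ ∀ p ∈ P,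
      AgreeAt (.copy o .one p) p M₁ v' ∧ AgreeAt (.copy o .two p) p M₂ v' from
    this.imp fun _ h => ⟨h.1, fun p hp => (h.2 p hp).1, fun p hp => (h.2 p hp).2⟩
  refine bigSeq_progress (D := localAtoms o σ)
    (T := fun p u => AgreeAt (.copy o .one p) p M₁ u ∧ AgreeAt (.copy o .two p) p M₂ u) ?_
    (pairwise_localAtoms hσ hP) ?_ ?_
  · exact fun p _ a ha => split_writes_subset p (.inl ha)
  · exact fun p _ u u' h hu => ⟨hu.1.congr fun a ha => h a (.inr ⟨_, .inl ha⟩),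
      hu.2.congr fun a ha => h a (.inr ⟨_, .inl ha⟩)⟩
  intro p hp u hu
  have hM := Model.split_iff.1 hM p
  have hs : AgreeAt (σ p) p M u := (hv p hp).congr fun a ha => (hu a (.inl ha)).symm
  have h₁ := @M₁.writable_readable p
  have h₂ := @M₂.writable_readable p
  have n₁ := hσ.ne_copy p p .one
  have n₂ := hσ.ne_copy p p .two
  clear hv hu
  simp only [Run, DFormula.sat_neg, DFormula.sat_and, sat_fv, sat_fR, sat_fW, and_assoc,
    exists_and_left, exists_eq_left', exists_eq_left, exists_or, or_and_right]
  simp only [AgreeAt] at hs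
  simp only [← hs.2.2, AgreeAt]
  -- The membership of `p` in the four permission sets of `M₁` and `M₂` determines the branch to
  -- take; RW-disjointness and `W ⊆ R` exclude the remaining combinations.
  by_cases hv : p ∈ M.val <;> by_cases hW₁ : p ∈ M₁.W <;> by_cases hW₂ : p ∈ M₂.W <;>
    by_cases hR₁ : p ∈ M₁.R <;> by_cases hR₂ : p ∈ M₂.R <;> simp_all

/-- After the simulation of a split, the copies of `p` describe two models into which the model
can be split, as far as `p` is concerned. -/
def SplitAt (o : List Bool) (p : V) (M : Model V) (u : Set (Atm (PVar V))) : Prop :=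
  (Atm.var (.copy o .one p) ∈ u ↔ p ∈ M.val) ∧ (Atm.var (.copy o .two p) ∈ u ↔ p ∈ M.val) ∧
    (Atm.W (.copy o .one p) ∈ u → Atm.R (.copy o .one p) ∈ u) ∧
    (Atm.W (.copy o .two p) ∈ u → Atm.R (.copy o .two p) ∈ u) ∧
    ¬ (Atm.W (.copy o .one p) ∈ u ∧ Atm.R (.copy o .two p) ∈ u) ∧
    ¬ (Atm.W (.copy o .two p) ∈ u ∧ Atm.R (.copy o .one p) ∈ u) ∧
    (p ∈ M.R ↔ Atm.R (.copy o .one p) ∈ u ∨ Atm.R (.copy o .two p) ∈ u) ∧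
    (p ∈ M.W ↔ Atm.W (.copy o .one p) ∈ u ∨ Atm.W (.copy o .two p) ∈ u)

theorem split_sound (hσ : Outside o σ) (hP : P.Nodup) (hv : Agree σ P M v)
    (h : (split o σ P).Run v v') : ∀ p ∈ P, SplitAt o p M v' := by
  refine bigSeq_sound (D := localAtoms o σ) (T := fun p u => SplitAt o p M u) ?_
    (pairwise_localAtoms hσ hP) ?_ ?_ h
  · exact fun p _ a ha => split_writes_subset p (.inl ha)
  · intro p _ u u' h hu
    have h (k) (a : Atm (PVar V)) (ha : a.base = .copy o k p) := h a (.inr ⟨k, .inl ha⟩)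
    simpa only [SplitAt, h _ (.var _) rfl, h _ (.R _) rfl, h _ (.W _) rfl] using hu
  intro p hp u u' hu h
  have hs : AgreeAt (σ p) p M u := (hv p hp).congr fun a ha => (hu a (.inl ha)).symm
  have hWR := @M.writable_readable p
  have n₁ := hσ.ne_copy p p .one
  have n₂ := hσ.ne_copy p p .two
  clear hv hu
  simp only [Run, DFormula.sat_neg, DFormula.sat_and, sat_fv, sat_fR, sat_fW, and_assoc,
    exists_and_left, exists_eq_left', exists_eq_left, exists_or, or_and_right] at h
  simp only [AgreeAt] at hs
  simp only [SplitAt, hs]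
  -- The branches are sound only because `W ⊆ R` in `M`: the branch for an unreadable variable gives
  -- no write permission, and the branch for a writable one always gives a read permission.
  rw [hs.1, hs.2.1] at hWR
  clear hs
  casesm* _ ∨ _, _ ∧ _ <;> subst u' <;> simp_all

theorem store_progress (hσ : Outside o σ) (hP : P.Nodup) : ∃ v', (store o P).Run v v' := by
  suffices ∃ v', (store o P).Run v v' ∧ ∀ p ∈ P, True from this.imp fun _ h => h.1
  refine bigSeq_progress (D := localAtoms o σ) (T := fun _ _ => True) ?_
    (pairwise_localAtoms hσ hP) ?_ ?_
  · exact fun p _ a ha => store_writes_subset p (.inl ha)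
  · exact fun _ _ _ _ _ _ => trivial
  · intro p _ u _
    simp only [Run, run_assign, exists_eq_left, exists_eq, and_true]

theorem store_sound (hσ : Outside o σ) (hP : P.Nodup) (h : (store o P).Run v v') :
    ∀ p ∈ P, ∀ k, (Atm.var (.copyR o k p) ∈ v' ↔ Atm.R (.copy o k p) ∈ v) ∧
      (Atm.var (.copyW o k p) ∈ v' ↔ Atm.W (.copy o k p) ∈ v) := by
  refine bigSeq_sound (D := localAtoms o σ) (T := fun p u => ∀ k,
    (Atm.var (.copyR o k p) ∈ u ↔ Atm.R (.copy o k p) ∈ v) ∧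
      (Atm.var (.copyW o k p) ∈ u ↔ Atm.W (.copy o k p) ∈ v)) ?_ (pairwise_localAtoms hσ hP) ?_ ?_ h
  · exact fun p _ a ha => store_writes_subset p (.inl ha)
  · intro p _ u u' h hu k
    rw [← h _ (.inr ⟨k, .inr (.inl rfl)⟩), ← h _ (.inr ⟨k, .inr (.inr rfl)⟩)]
    exact hu k
  · intro p _ u u' hu h k
    -- The property compares with the initial valuation `v`, but the permission atoms of the copies
    -- lie in the domain of `p`, where `u` and `v` coincide.
    rw [← hu (.R (.copy o k p)) (.inr ⟨k, .inl rfl⟩), ← hu (.W (.copy o k p)) (.inr ⟨k, .inl rfl⟩)]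
    simp only [Run, run_assign, exists_eq_left] at h
    subst u'
    cases k <;> simp

/-- Some guard always holds: if `p` is writable then one of its copies is, and that copy is either
true or false. Agreement at the end is left to `merge_sound`, which holds for every run. -/
theorem merge_progress (hσ : Outside o σ) (hP : P.Nodup) {M' M₁' M₂' : Model V}
    (hv : Agree σ P M v) (hv₁ : Agree (.copy o .one) P M₁' v) (hv₂ : Agree (.copy o .two) P M₂' v)
    (hM : M'.Merge M₁' M₂') (hL : M.Legal M') :
    ∃ v', (merge o σ P).Run v v' := by
  suffices ∃ v', (merge o σ P).Run v v' ∧ ∀ p ∈ P, True from this.imp fun _ h => h.1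
  refine bigSeq_progress (D := localAtoms o σ) (T := fun _ _ => True)
    (fun p _ a ha => merge_writes_subset p (.inl ha))
    (pairwise_localAtoms hσ hP) (fun _ _ _ _ _ _ => trivial) ?_
  intro p hp u hu
  have hM := Model.merge_iff.1 hM p
  have hL := Model.legal_iff.1 hL p
  have hs : AgreeAt (σ p) p M u := (hv p hp).congr fun a ha => (hu a (.inl ha)).symm
  have hs₁ : AgreeAt _ p M₁' u := (hv₁ p hp).congr fun a ha => (hu a (.inr ⟨_, .inl ha⟩)).symm
  have hs₂ : AgreeAt _ p M₂' u := (hv₂ p hp).congr fun a ha => (hu a (.inr ⟨_, .inl ha⟩)).symm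
  clear hv hv₁ hv₂ hu
  simp only [Run, DFormula.sat_neg, DFormula.sat_and, DFormula.sat_or, sat_fv, sat_fW, and_assoc,
    exists_and_left, exists_eq_left', exists_eq_left, exists_or, or_and_right, and_true, exists_eq]
  simp only [AgreeAt] at hs hs₁ hs₂
  simp only [← hs.2.1, ← hs₁.2.1, ← hs₁.2.2, ← hs₂.2.1, ← hs₂.2.2]
  grind only

/-- The two assigning guards cannot both hold, since by RW-disjointness and `W ⊆ R` at most one copy
is writable, and that copy decides the merged value. A non-writable variable keeps its value by
legality. The resets touch only copies, about which agreement through `σ` says nothing. -/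
theorem merge_sound (hσ : Outside o σ) (hP : P.Nodup) {M' M₁' M₂' : Model V}
    (hv : Agree σ P M v) (hv₁ : Agree (.copy o .one) P M₁' v) (hv₂ : Agree (.copy o .two) P M₂' v)
    (hM : M'.Merge M₁' M₂') (hL : M.Legal M') (h : (merge o σ P).Run v v') : Agree σ P M' v' := by
  refine bigSeq_sound (D := localAtoms o σ) (T := fun p u => AgreeAt (σ p) p M' u)
    (fun p _ a ha => merge_writes_subset p (.inl ha))
    (pairwise_localAtoms hσ hP) (fun p _ u u' h hu => hu.congr fun a ha => h a (.inl ha)) ?_ h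
  intro p hp u u' hu h
  have hM := Model.merge_iff.1 hM p
  have hL := Model.legal_iff.1 hL p
  have hs : AgreeAt (σ p) p M u := (hv p hp).congr fun a ha => (hu a (.inl ha)).symm
  have hs₁ : AgreeAt _ p M₁' u := (hv₁ p hp).congr fun a ha => (hu a (.inr ⟨_, .inl ha⟩)).symm
  have hs₂ : AgreeAt _ p M₂' u := (hv₂ p hp).congr fun a ha => (hu a (.inr ⟨_, .inl ha⟩)).symm
  have r₁ := @M₁'.writable_readable p
  have r₂ := @M₂'.writable_readable p
  have n := hσ.ne_copy p p
  have nR := hσ.ne_copyR p p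
  have nW := hσ.ne_copyW p p
  clear hv hv₁ hv₂ hu
  simp only [Run, DFormula.sat_neg, DFormula.sat_and, DFormula.sat_or, sat_fv, sat_fW, and_assoc,
    exists_and_left, exists_eq_left', exists_eq_left, exists_or, or_and_right] at h
  simp only [AgreeAt] at hs hs₁ hs₂
  simp only [← hs.2.1, ← hs₁.2.1, ← hs₁.2.2, ← hs₂.2.1, ← hs₂.2.2] at h
  clear hs₁ hs₂
  rcases hs with ⟨eR, eW, ev⟩
  casesm* _ ∨ _, _ ∧ _ <;> subst u' <;>
    simp [AgreeAt, n, nR, nW, ← eR, ← eW, ← ev] <;> clear eR eW ev n nR nW <;> grind only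

theorem pairwise_base (hσ : Function.Injective σ) (hP : P.Nodup) :
    P.Pairwise fun p q => Disjoint (baseAtoms (σ p)) (baseAtoms (σ q)) :=
  hP.imp fun hpq => Set.disjoint_left.2 fun _ ha hb => hpq (hσ (ha.symm.trans hb))

/-- An indistinguishable model differs only in the values of unreadable variables, and these are the
values that the loop chooses freely. -/
theorem vary_progress (hσ : Function.Injective σ) (hP : P.Nodup) {M' : Model V}
    (hv : Agree σ P M v) (hM : M'.Indist M) : ∃ v', (vary σ P).Run v v' ∧ Agree σ P M' v' := by
  refine bigSeq_progress (D := fun p => baseAtoms (σ p)) (T := fun p u => AgreeAt (σ p) p M' u)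
    (fun p _ a ha => vary_writes_subset p (.inl ha))
    (pairwise_base hσ hP) (fun p _ u u' h hu => hu.congr h) ?_
  intro p hp u hu
  have hs : AgreeAt (σ p) p M u := (hv p hp).congr fun a ha => (hu a ha).symm
  obtain ⟨hR, hW, hV⟩ := hM
  have hV := Set.ext_iff.1 hV p
  simp only [Set.mem_inter_iff, hR] at hV
  simp only [Run, DFormula.sat_neg, sat_fR, and_assoc, exists_and_left, exists_eq_left',
    exists_eq_left, exists_or, or_and_right]
  simp only [AgreeAt] at hs
  simp only [AgreeAt, hR, hW, ← hs.1]
  by_cases h : p ∈ M.R <;> by_cases h' : p ∈ M'.val <;> simp_all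

/-- Only the values of unreadable variables are varied. -/
theorem vary_sound (hσ : Function.Injective σ) (hP : P.Nodup)
    (hv : Agree σ P M v) (h : (vary σ P).Run v v') : ∀ p ∈ P, p ∈ M.R →
    (Atm.var (σ p) ∈ v' ↔ p ∈ M.val) := by
  refine bigSeq_sound (D := fun p => baseAtoms (σ p))
    (T := fun p u => p ∈ M.R → (Atm.var (σ p) ∈ u ↔ p ∈ M.val))
    (fun p _ a ha => vary_writes_subset p (.inl ha))
    (pairwise_base hσ hP) (fun p _ u u' h hu hp => (h (.var (σ p)) rfl).symm.trans (hu hp)) ?_ h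
  intro p hp u u' hu h hR
  have hs : AgreeAt (σ p) p M u := (hv p hp).congr fun a ha => (hu a ha).symm
  -- Readability closes the assigning branch, so only the test that changes nothing remains.
  have hR' := hs.1.1 hR
  simp only [Run, DFormula.sat_neg, sat_fR, hR', not_true, false_and, and_false, exists_false,
    or_false, and_true] at h
  rw [← h, hs.2.2]

end Bodies

-- The legality test and the atoms written by a translation

theorem sat_okChange {o : List Bool} {σ : V → PVar V} {P : List V} {v : Set (Atm (PVar V))} :
    (okChange o σ P).Sat v ↔ ∀ p ∈ P, ∀ k,
      (Atm.var (.copyR o k p) ∈ v ↔ Atm.R (.copy o k p) ∈ v) ∧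
      (Atm.var (.copyW o k p) ∈ v ↔ Atm.W (.copy o k p) ∈ v) ∧
      (Atm.var (.copyW o k p) ∉ v → (Atm.var (σ p) ∈ v ↔ Atm.var (.copy o k p) ∈ v)) := by
  rw [okChange, DFormula.sat_bigAnd]
  refine forall₂_congr fun p _ => ?_
  simp only [DFormula.sat_and, DFormula.sat_iff, DFormula.sat_imp, DFormula.sat_neg, sat_fv, sat_fR,
    sat_fW]
  exact ⟨fun h k => by cases k; exacts [h.1, h.2], fun h => ⟨h .one, h .two⟩⟩

/-- A translated program interferes only with the renamed variables of the program and with names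
that are fresh at or below its address. In the parallel case the components see only copies made at
`o`, so just the merge reaches the variables `σ p`. -/
theorem base_of_mem_writes_transAt [DecidableEq V] : ∀ (π : Program V) (o : List Bool)
    (σ : V → PVar V) {a : Atm (PVar V)}, a ∈ (π.transAt o σ).writes →
    (∃ p ∈ π.vars, a.base = σ p) ∨ a.base.Under o
  | .setV p, o, σ, a, h => by
      simp only [Program.transAt, DProgram.writes, Set.mem_union, Set.mem_singleton_iff,
        Set.mem_empty_iff_false, false_or] at h
      exact .inl ⟨p, by simp [Program.vars], by rw [h]; rfl⟩
  | .unsetV p, o, σ, a, h => by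
      simp only [Program.transAt, DProgram.writes, Set.mem_union, Set.mem_singleton_iff,
        Set.mem_empty_iff_false, false_or] at h
      exact .inl ⟨p, by simp [Program.vars], by rw [h]; rfl⟩
  | .setR p, o, σ, a, h => by
      simp only [Program.transAt, DProgram.writes, Set.mem_singleton_iff] at h
      exact .inl ⟨p, by simp [Program.vars], by rw [h]; rfl⟩
  | .unsetR p, o, σ, a, h => by
      simp only [Program.transAt, DProgram.writes, Set.mem_union, Set.mem_singleton_iff] at h
      exact .inl ⟨p, by simp [Program.vars], by rcases h with rfl | rfl <;> rfl⟩
  | .setW p, o, σ, a, h => by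
      simp only [Program.transAt, DProgram.writes, Set.mem_union, Set.mem_singleton_iff] at h
      exact .inl ⟨p, by simp [Program.vars], by rcases h with rfl | rfl <;> rfl⟩
  | .unsetW p, o, σ, a, h => by
      simp only [Program.transAt, DProgram.writes, Set.mem_singleton_iff] at h
      exact .inl ⟨p, by simp [Program.vars], by rw [h]; rfl⟩
  | .test φ, o, σ, a, h => by simp [Program.transAt, DProgram.writes] at h
  | .endoTest φ, o, σ, a, h => by simp [Program.transAt, DProgram.writes] at h
  | .seq π ρ, o, σ, a, h => by
      simp only [Program.transAt, DProgram.writes, Set.mem_union] at h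
      simp only [Program.vars, List.mem_union_iff]
      rcases h with h | h
      · exact (base_of_mem_writes_transAt π _ σ h).imp (fun ⟨p, hp, e⟩ => ⟨p, .inl hp, e⟩)
          PVar.Under.of_cons
      · exact (base_of_mem_writes_transAt ρ _ σ h).imp (fun ⟨p, hp, e⟩ => ⟨p, .inr hp, e⟩)
          PVar.Under.of_cons
  | .choice π ρ, o, σ, a, h => by
      simp only [Program.transAt, DProgram.writes, Set.mem_union] at h
      simp only [Program.vars, List.mem_union_iff]
      rcases h with h | h
      · exact (base_of_mem_writes_transAt π _ σ h).imp (fun ⟨p, hp, e⟩ => ⟨p, .inl hp, e⟩)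
          PVar.Under.of_cons
      · exact (base_of_mem_writes_transAt ρ _ σ h).imp (fun ⟨p, hp, e⟩ => ⟨p, .inr hp, e⟩)
          PVar.Under.of_cons
  | .star π, o, σ, a, h => by
      simp only [Program.transAt, DProgram.writes] at h
      exact (base_of_mem_writes_transAt π _ σ h).imp id PVar.Under.of_cons
  | .par π ρ, o, σ, a, h => by
      simp only [Program.transAt, flatten, DProgram.writes, Set.mem_union,
        Set.mem_empty_iff_false, false_or] at h
      rcases h with h | h | h | h | h
      · obtain ⟨p, -, k, h⟩ := base_of_mem_writes_split h
        rw [h]; exact .inr List.suffix_rfl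
      · obtain ⟨p, -, k, h | h⟩ := base_of_mem_writes_store h <;>
          rw [h] <;> exact .inr List.suffix_rfl
      · obtain ⟨p, -, h⟩ | h := base_of_mem_writes_transAt π _ _ h
        · rw [h]; exact .inr List.suffix_rfl
        · exact .inr h.of_cons
      · obtain ⟨p, -, h⟩ | h := base_of_mem_writes_transAt ρ _ _ h
        · rw [h]; exact .inr List.suffix_rfl
        · exact .inr h.of_cons
      · obtain ⟨p, hp, h | ⟨k, h | h | h⟩⟩ := base_of_mem_writes_merge h
        · rw [h]; exact .inl ⟨p, hp, rfl⟩
        all_goals rw [h]; exact .inr List.suffix_rfl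

theorem Agree.run {σ : V → PVar V} {S : List V} {M : Model V} {v v' : Set (Atm (PVar V))}
    {τ : TProgram V} (h : τ.Run v v') (hv : Agree σ S M v)
    (hw : ∀ a ∈ τ.writes, ∀ p ∈ S, a.base ≠ σ p) : Agree σ S M v' := fun p hp =>
  (hv p hp).congr fun a ha => (h.mem_iff _ a fun h => hw a h p hp ha).symm

-- Simulation, and how splits and merges fit together

/-- The program `τ` on valuations simulates the program `π` on models and conversely. -/
def Simulates (σ : V → PVar V) (S : List V) (π : Program V) (τ : TProgram V) : Prop :=
  ∀ M v, Agree σ S M v →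
    (∀ M', π.Run M M' → ∃ v', τ.Run v v' ∧ Agree σ S M' v') ∧
    (∀ v', τ.Run v v' → ∃ M', π.Run M M' ∧ Agree σ S M' v')

/-- A variable not writable in `M` is writable on neither side, so both sides keep its common value
and the merge returns that value. -/
theorem Model.legal_of_split_of_merge {M M₁ M₂ M' M₁' M₂' : Model V} (hs : M.Split M₁ M₂)
    (hm : M'.Merge M₁' M₂') (h₁ : M₁.Legal M₁') (h₂ : M₂.Legal M₂') : M.Legal M' := by
  rw [Model.legal_iff]
  intro p
  have hs := Model.split_iff.1 hs p
  have hm := Model.merge_iff.1 hm p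
  have h₁ := Model.legal_iff.1 h₁ p
  have h₂ := Model.legal_iff.1 h₂ p
  grind only

/-- The outcome of a parallel composition, as a function of the outcomes of its components. -/
def Model.join (M M₁' M₂' : Model V) : Model V where
  R := M.R
  W := M.W
  val := (M₁'.val ∩ M₁'.W) ∪ (M₂'.val ∩ M₂'.W) ∪ (M₁'.val ∩ M₂'.val)
  writable_readable := M.writable_readable

/-- Legal moves preserve the permissions, hence RW-disjointness and the unions. Off the writable
variables both outcomes still have the values of `M`, so they coincide there. -/
theorem Model.merge_join {M M₁ M₂ M₁' M₂' : Model V} (hs : M.Split M₁ M₂)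
    (h₁ : M₁.Legal M₁') (h₂ : M₂.Legal M₂') : (M.join M₁' M₂').Merge M₁' M₂' := by
  rw [Model.merge_iff]
  intro p
  have hs := Model.split_iff.1 hs p
  have h₁ := Model.legal_iff.1 h₁ p
  have h₂ := Model.legal_iff.1 h₂ p
  have hR : p ∈ (M.join M₁' M₂').R ↔ p ∈ M.R := Iff.rfl
  have hW : p ∈ (M.join M₁' M₂').W ↔ p ∈ M.W := Iff.rfl
  rw [hR, hW]
  refine ⟨?_, ?_, ?_, ?_, ?_, Iff.rfl⟩ <;> clear hR hW <;> grind only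

/-- A copy of a model on the variables in `P`, as it is found in a valuation; the remaining
readable and writable variables are prescribed. -/
def copyModel (o : List Bool) (k : Side) (P : List V) (M : Model V) (v : Set (Atm (PVar V)))
    (R₀ W₀ : Set V) (h₀ : W₀ ⊆ R₀)
    (h : ∀ p ∈ P, Atm.W (.copy o k p) ∈ v → Atm.R (.copy o k p) ∈ v) : Model V where
  R := {p | (p ∈ P ∧ Atm.R (.copy o k p) ∈ v) ∨ (p ∉ P ∧ p ∈ R₀)}
  W := {p | (p ∈ P ∧ Atm.W (.copy o k p) ∈ v) ∨ (p ∉ P ∧ p ∈ W₀)}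
  val := M.val
  writable_readable := fun p hp => hp.imp (fun hp => ⟨hp.1, h p hp.1 hp.2⟩)
    fun hp => ⟨hp.1, h₀ hp.2⟩

theorem exists_split {o : List Bool} {P : List V} {M : Model V} {v : Set (Atm (PVar V))}
    (h : ∀ p ∈ P, SplitAt o p M v) : ∃ M₁ M₂ : Model V, M.Split M₁ M₂ ∧
      Agree (.copy o .one) P M₁ v ∧ Agree (.copy o .two) P M₂ v := by
  -- The valuation determines the split only on `P`. Elsewhere all permissions go to the first side
  -- and none to the second, which is always a valid split.
  refine ⟨copyModel o .one P M v M.R M.W M.writable_readable fun p hp => (h p hp).2.2.1,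
    copyModel o .two P M v ∅ ∅ subset_rfl fun p hp => (h p hp).2.2.2.1, ?_, ?_, ?_⟩
  · rw [Model.split_iff]
    intro p
    by_cases hp : p ∈ P
    · have := h p hp
      simp only [SplitAt] at this
      simpa [copyModel, hp] using this.2.2.2.2
    · simp [copyModel, hp]
  · intro p hp
    simp [AgreeAt, copyModel, hp, (h p hp).1]
  · intro p hp
    simp [AgreeAt, copyModel, hp, (h p hp).2.1]

-- The simulation of parallel composition

section Par

variable {o : List Bool} {σ : V → PVar V} {S P : List V} {π ρ : Program V}
  {τ₁ τ₂ : TProgram V}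

/-- The atoms assigned by the translation of a component of a parallel composition. -/
def WritesCopies (o : List Bool) (k : Side) (τ : TProgram V) : Prop :=
  ∀ a ∈ τ.writes, (∃ p, a.base = .copy o k p) ∨ ∃ b, a.base.Under (b :: o)

theorem WritesCopies.under {k : Side} {τ : TProgram V} (h : WritesCopies o k τ)
    {a : Atm (PVar V)} (ha : a ∈ τ.writes) : a.base.Under o := by
  rcases h a ha with ⟨p, h⟩ | ⟨b, h⟩
  · rw [h]; exact List.suffix_rfl
  · exact h.of_cons

/-- This non-interference is what allows the components to run in sequence: the copies of the other
side carry a different index and an address too short to belong to a nested operator. -/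
theorem WritesCopies.ne_copy {k k' : Side} {τ : TProgram V} (h : WritesCopies o k τ)
    (hk : k ≠ k') {a : Atm (PVar V)} (ha : a ∈ τ.writes) (p : V) : a.base ≠ .copy o k' p := by
  intro e
  rcases h a ha with ⟨p, h⟩ | ⟨b, h⟩ <;> rw [e] at h
  · simp [hk.symm] at h
  · exact not_cons_suffix b o h

theorem WritesCopies.notMem_copyR {k : Side} {τ : TProgram V} (h : WritesCopies o k τ)
    (k' : Side) (p : V) : Atm.var (.copyR o k' p) ∉ τ.writes := by
  intro ha
  rcases h _ ha with ⟨p, h⟩ | ⟨b, h⟩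
  · simp [Atm.base] at h
  · exact not_cons_suffix b o h

theorem WritesCopies.notMem_copyW {k : Side} {τ : TProgram V} (h : WritesCopies o k τ)
    (k' : Side) (p : V) : Atm.var (.copyW o k' p) ∉ τ.writes := by
  intro ha
  rcases h _ ha with ⟨p, h⟩ | ⟨b, h⟩
  · simp [Atm.base] at h
  · exact not_cons_suffix b o h

/-- What is known before the two components of a parallel composition are run one after the
other. -/
theorem agree_of_split_store (hσ : Outside o σ) (hP : P.Nodup) {M M₁ M₂ : Model V}
    {v v₁ v₂ : Set (Atm (PVar V))} (hv : Agree σ S M v) (h : (split o σ P).Run v v₁)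
    (h' : (store o P).Run v₁ v₂) (h₁ : Agree (.copy o .one) P M₁ v₁)
    (h₂ : Agree (.copy o .two) P M₂ v₁) :
    Agree σ S M v₂ ∧ Agree (.copy o .one) P M₁ v₂ ∧ Agree (.copy o .two) P M₂ v₂ ∧
    (∀ p ∈ P, (Atm.var (.copyR o .one p) ∈ v₂ ↔ p ∈ M₁.R) ∧
      (Atm.var (.copyW o .one p) ∈ v₂ ↔ p ∈ M₁.W)) ∧
    (∀ p ∈ P, (Atm.var (.copyR o .two p) ∈ v₂ ↔ p ∈ M₂.R) ∧
      (Atm.var (.copyW o .two p) ∈ v₂ ↔ p ∈ M₂.W)) := by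
  have hst := store_sound hσ hP h'
  refine ⟨(hv.run h ?_).run h' ?_, h₁.run h' ?_, h₂.run h' ?_, fun p hp => ?_, fun p hp => ?_⟩
  · intro a ha p _ e
    obtain ⟨q, -, k, h⟩ := base_of_mem_writes_split ha
    exact hσ.ne_copy _ _ _ (e.symm.trans h)
  · intro a ha p _ e
    obtain ⟨q, -, k, h | h⟩ := base_of_mem_writes_store ha
    · exact hσ.ne_copyR _ _ _ (e.symm.trans h)
    · exact hσ.ne_copyW _ _ _ (e.symm.trans h)
  · intro a ha p _ e
    obtain ⟨q, -, k, h | h⟩ := base_of_mem_writes_store ha <;> simp [e] at h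
  · intro a ha p _ e
    obtain ⟨q, -, k, h | h⟩ := base_of_mem_writes_store ha <;> simp [e] at h
  · exact ⟨(hst p hp .one).1.trans (h₁ p hp).1.symm, (hst p hp .one).2.trans (h₁ p hp).2.1.symm⟩
  · exact ⟨(hst p hp .two).1.trans (h₂ p hp).1.symm, (hst p hp .two).2.trans (h₂ p hp).2.1.symm⟩

/-- The test between the components and the merge succeeds iff both components have only made
legal changes. -/
theorem sat_okChange_iff {M M₁ M₂ M₁' M₂' : Model V}
    {v₂ v₃ v₄ : Set (Atm (PVar V))} (hw₁ : WritesCopies o .one τ₁) (hw₂ : WritesCopies o .two τ₂)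
    (hs : M.Split M₁ M₂)
    (hR₁ : ∀ p ∈ P, (Atm.var (.copyR o .one p) ∈ v₂ ↔ p ∈ M₁.R) ∧
      (Atm.var (.copyW o .one p) ∈ v₂ ↔ p ∈ M₁.W))
    (hR₂ : ∀ p ∈ P, (Atm.var (.copyR o .two p) ∈ v₂ ↔ p ∈ M₂.R) ∧
      (Atm.var (.copyW o .two p) ∈ v₂ ↔ p ∈ M₂.W))
    (h₁ : τ₁.Run v₂ v₃) (h₂ : τ₂.Run v₃ v₄) (hv : Agree σ P M v₄)
    (hv₁ : Agree (.copy o .one) P M₁' v₄) (hv₂ : Agree (.copy o .two) P M₂' v₄)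
    (hf₁ : ∀ p ∉ P, M₁.SameAt p M₁') (hf₂ : ∀ p ∉ P, M₂.SameAt p M₂') :
    (okChange o σ P).Sat v₄ ↔ M₁.Legal M₁' ∧ M₂.Legal M₂' := by
  rw [sat_okChange, Model.legal_iff, Model.legal_iff, ← forall_and]
  -- Neither component writes the stored flags, so after both runs they still record the permissions
  -- given by the split.
  have hR (k p) : Atm.var (.copyR o k p) ∈ v₄ ↔ Atm.var (.copyR o k p) ∈ v₂ :=
    (h₂.mem_iff _ _ (hw₂.notMem_copyR k p)).trans (h₁.mem_iff _ _ (hw₁.notMem_copyR k p))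
  have hW (k p) : Atm.var (.copyW o k p) ∈ v₄ ↔ Atm.var (.copyW o k p) ∈ v₂ :=
    (h₂.mem_iff _ _ (hw₂.notMem_copyW k p)).trans (h₁.mem_iff _ _ (hw₁.notMem_copyW k p))
  have key (p) (hp : p ∈ P) : (∀ k,
      (Atm.var (.copyR o k p) ∈ v₄ ↔ Atm.R (.copy o k p) ∈ v₄) ∧
      (Atm.var (.copyW o k p) ∈ v₄ ↔ Atm.W (.copy o k p) ∈ v₄) ∧
      (Atm.var (.copyW o k p) ∉ v₄ → (Atm.var (σ p) ∈ v₄ ↔ Atm.var (.copy o k p) ∈ v₄))) ↔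
      ((p ∈ M₁.R ↔ p ∈ M₁'.R) ∧ (p ∈ M₁.W ↔ p ∈ M₁'.W) ∧
        (p ∉ M₁.W → (p ∈ M₁.val ↔ p ∈ M₁'.val))) ∧
      ((p ∈ M₂.R ↔ p ∈ M₂'.R) ∧ (p ∈ M₂.W ↔ p ∈ M₂'.W) ∧
        (p ∉ M₂.W → (p ∈ M₂.val ↔ p ∈ M₂'.val))) := by
    have hs := Model.split_iff.1 hs p
    have e₁ := hv₁ p hp
    have e₂ := hv₂ p hp
    have e := hv p hp
    simp only [AgreeAt] at e₁ e₂ e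
    -- Both sides of a split start with the values of `M`; this is why the test may compare each
    -- copy with `σ p`, which the components leave alone.
    rw [← hs.2.2.2.2.1, ← hs.2.2.2.2.2, e₁.1, e₁.2.1, e₁.2.2, e₂.1, e₂.2.1, e₂.2.2, e.2.2,
      ← (hR₁ p hp).1, ← (hR₁ p hp).2, ← (hR₂ p hp).1, ← (hR₂ p hp).2, ← hR, ← hW, ← hR, ← hW]
    exact ⟨fun h => ⟨h .one, h .two⟩, fun h k => by cases k; exacts [h.1, h.2]⟩
  refine ⟨fun h p => ?_, fun h p hp => (key p hp).2 (h p)⟩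
  by_cases hp : p ∈ P
  · exact (key p hp).1 (h p hp)
  -- The test is silent outside `P`, but there nothing changes, so legality is automatic.
  · obtain ⟨a, b, c⟩ := hf₁ p hp
    obtain ⟨a', b', c'⟩ := hf₂ p hp
    exact ⟨⟨a, b, fun _ => c⟩, a', b', fun _ => c'⟩

/-- The merge loop establishes agreement on `P` only. On the rest of `S` neither the loop nor the
model changes anything. -/
theorem Agree.of_merge {M M' : Model V} {v v' : Set (Atm (PVar V))} (hσ : Outside o σ)
    (hv : Agree σ S M v) (h : (merge o σ P).Run v v') (hP : Agree σ P M' v')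
    (hf : ∀ p ∉ P, M.SameAt p M') : Agree σ S M' v' := by
  intro p hp
  by_cases hpP : p ∈ P
  · exact hP p hpP
  refine ((hv p hp).congr fun a ha => (h.mem_iff _ a fun haw => ?_).symm).model (hf p hpP)
  obtain ⟨q, hq, e | ⟨k, e | e | e⟩⟩ := base_of_mem_writes_merge haw
  · rw [e] at ha
    exact hpP (hσ.inj ha ▸ hq)
  · exact hσ.ne_copy _ _ _ (ha.symm.trans e)
  · exact hσ.ne_copyR _ _ _ (ha.symm.trans e)
  · exact hσ.ne_copyW _ _ _ (ha.symm.trans e)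

theorem Simulates.par [DecidableEq V] (hσ : Outside o σ) (hP : (π.vars ∪ ρ.vars).Nodup)
    (hS : ∀ p ∈ π.vars ∪ ρ.vars, p ∈ S)
    (hw₁ : WritesCopies o .one τ₁) (hw₂ : WritesCopies o .two τ₂)
    (h₁ : Simulates (.copy o .one) (π.vars ∪ ρ.vars) π τ₁)
    (h₂ : Simulates (.copy o .two) (π.vars ∪ ρ.vars) ρ τ₂) :
    Simulates σ S (.par π ρ) (flatten o σ (π.vars ∪ ρ.vars) τ₁ τ₂) := by
  intro M v hv
  have hf : ∀ M', (Program.par π ρ).Run M M' → ∀ p ∉ π.vars ∪ ρ.vars, M.SameAt p M' :=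
    fun M' h => Program.Run.sameAt (.par π ρ) h
  have hf₁ {M M' : Model V} (h : π.Run M M') (p) (hp : p ∉ π.vars ∪ ρ.vars) : M.SameAt p M' :=
    Program.Run.sameAt π h p fun h => hp (List.mem_union_iff.2 (.inl h))
  have hf₂ {M M' : Model V} (h : ρ.Run M M') (p) (hp : p ∉ π.vars ∪ ρ.vars) : M.SameAt p M' :=
    Program.Run.sameAt ρ h p fun h => hp (List.mem_union_iff.2 (.inr h))
  have sub : ∀ {M v}, Agree σ S M v → Agree σ (π.vars ∪ ρ.vars) M v := fun h p hp => h p (hS p hp)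
  generalize π.vars ∪ ρ.vars = P at *
  constructor
  · intro M' hrun
    have hf := hf M' hrun
    obtain ⟨M₁, M₂, M₁', M₂', hs, hm, r₁, l₁, r₂, l₂⟩ := hrun
    obtain ⟨v₁, hsplit, c₁, c₂⟩ := split_progress hσ hP (sub hv) hs
    obtain ⟨v₂, hstore⟩ := store_progress (v := v₁) hσ hP
    obtain ⟨b, b₁, b₂, s₁, s₂⟩ := agree_of_split_store hσ hP hv hsplit hstore c₁ c₂
    obtain ⟨v₃, t₁, d₁⟩ := (h₁ M₁ v₂ b₁).1 M₁' r₁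
    -- The first component leaves the copies of the second alone, so the second still starts from
    -- `M₂` although it runs later.
    have d₂ := b₂.run t₁ fun a ha p _ => hw₁.ne_copy (by simp) ha p
    obtain ⟨v₄, t₂, e₂⟩ := (h₂ M₂ v₃ d₂).1 M₂' r₂
    have e₁ := d₁.run t₂ fun a ha p _ => hw₂.ne_copy (by simp) ha p
    have e := (b.run t₁ fun a ha p _ h => hσ.not_under p (h ▸ hw₁.under ha)).run t₂
      fun a ha p _ h => hσ.not_under p (h ▸ hw₂.under ha)
    have hok := (sat_okChange_iff hw₁ hw₂ hs s₁ s₂ t₁ t₂ (sub e) e₁ e₂ (hf₁ r₁) (hf₂ r₂)).2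
      ⟨l₁, l₂⟩
    have hL := Model.legal_of_split_of_merge hs hm l₁ l₂
    obtain ⟨v₅, hmerge⟩ := merge_progress hσ hP (sub e) e₁ e₂ hm hL
    exact ⟨v₅, ⟨v₁, hsplit, v₂, hstore, v₃, t₁, v₄, t₂, v₄, ⟨rfl, hok⟩, hmerge⟩,
      e.of_merge hσ hmerge (merge_sound hσ hP (sub e) e₁ e₂ hm hL hmerge) hf⟩
  · rintro v₅ ⟨v₁, hsplit, v₂, hstore, v₃, t₁, v₄, t₂, _, ⟨rfl, hok⟩, hmerge⟩
    obtain ⟨M₁, M₂, hs, c₁, c₂⟩ := exists_split (split_sound hσ hP (sub hv) hsplit)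
    obtain ⟨b, b₁, b₂, s₁, s₂⟩ := agree_of_split_store hσ hP hv hsplit hstore c₁ c₂
    obtain ⟨M₁', r₁, d₁⟩ := (h₁ M₁ v₂ b₁).2 v₃ t₁
    have d₂ := b₂.run t₁ fun a ha p _ => hw₁.ne_copy (by simp) ha p
    obtain ⟨M₂', r₂, e₂⟩ := (h₂ M₂ v₃ d₂).2 v₄ t₂
    have e₁ := d₁.run t₂ fun a ha p _ => hw₂.ne_copy (by simp) ha p
    have e := (b.run t₁ fun a ha p _ h => hσ.not_under p (h ▸ hw₁.under ha)).run t₂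
      fun a ha p _ h => hσ.not_under p (h ▸ hw₂.under ha)
    obtain ⟨l₁, l₂⟩ :=
      (sat_okChange_iff hw₁ hw₂ hs s₁ s₂ t₁ t₂ (sub e) e₁ e₂ (hf₁ r₁) (hf₂ r₂)).1 hok
    -- The valuation run does not supply the final model; it is built from the outcomes of the two
    -- components.
    have hm := Model.merge_join hs l₁ l₂
    have hL := Model.legal_of_split_of_merge hs hm l₁ l₂
    have hrun : (Program.par π ρ).Run M (M.join M₁' M₂') :=
      ⟨M₁, M₂, M₁', M₂', hs, hm, r₁, l₁, r₂, l₂⟩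
    exact ⟨_, hrun, e.of_merge hσ hmerge (merge_sound hσ hP (sub e) e₁ e₂ hm hL hmerge)
      (hf _ hrun)⟩

end Par

-- The simulation of the other program operators

section Simulation

variable {o : List Bool} {σ : V → PVar V} {S : List V} {π ρ : Program V} {τ τ' : TProgram V}

theorem Simulates.seq (h : Simulates σ S π τ) (h' : Simulates σ S ρ τ') :
    Simulates σ S (.seq π ρ) (.seq τ τ') := by
  intro M v hv
  constructor
  · rintro M' ⟨M₁, r₁, r₂⟩
    obtain ⟨v₁, t₁, hv₁⟩ := (h M v hv).1 M₁ r₁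
    obtain ⟨v', t₂, hv'⟩ := (h' M₁ v₁ hv₁).1 M' r₂
    exact ⟨v', ⟨v₁, t₁, t₂⟩, hv'⟩
  · rintro v' ⟨v₁, t₁, t₂⟩
    obtain ⟨M₁, r₁, hv₁⟩ := (h M v hv).2 v₁ t₁
    obtain ⟨M', r₂, hv'⟩ := (h' M₁ v₁ hv₁).2 v' t₂
    exact ⟨M', ⟨M₁, r₁, r₂⟩, hv'⟩

theorem Simulates.choice (h : Simulates σ S π τ) (h' : Simulates σ S ρ τ') :
    Simulates σ S (.choice π ρ) (.choice τ τ') := by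
  intro M v hv
  constructor
  · rintro M' (r | r)
    · exact ((h M v hv).1 M' r).imp fun _ h => ⟨.inl h.1, h.2⟩
    · exact ((h' M v hv).1 M' r).imp fun _ h => ⟨.inr h.1, h.2⟩
  · rintro v' (t | t)
    · exact ((h M v hv).2 v' t).imp fun _ h => ⟨.inl h.1, h.2⟩
    · exact ((h' M v hv).2 v' t).imp fun _ h => ⟨.inr h.1, h.2⟩

theorem Simulates.star (h : Simulates σ S π τ) : Simulates σ S (.star π) (.star τ) := by
  intro M v hv
  constructor
  · intro M' r
    change Relation.ReflTransGen π.Run M M' at r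
    change ∃ v', Relation.ReflTransGen τ.Run v v' ∧ _
    induction r with
    | refl => exact ⟨v, .refl, hv⟩
    | tail _ r ih =>
      obtain ⟨v₁, t₁, hv₁⟩ := ih
      obtain ⟨v', t, hv'⟩ := (h _ v₁ hv₁).1 _ r
      exact ⟨v', t₁.tail t, hv'⟩
  · intro v' t
    change Relation.ReflTransGen τ.Run v v' at t
    change ∃ M', Relation.ReflTransGen π.Run M M' ∧ _
    induction t with
    | refl => exact ⟨M, .refl, hv⟩
    | tail _ t ih =>
      obtain ⟨M₁, r₁, hv₁⟩ := ih
      obtain ⟨M', r, hv'⟩ := (h M₁ _ hv₁).2 _ t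
      exact ⟨M', r₁.tail r, hv'⟩

theorem Simulates.test {φ : Formula V} {φ' : TFormula V}
    (h : ∀ M v, Agree σ S M v → (φ.Sat M ↔ φ'.Sat v)) : Simulates σ S (.test φ) (.test φ') := by
  intro M v hv
  constructor
  · rintro M' ⟨rfl, hφ⟩
    exact ⟨v, ⟨rfl, (h M v hv).1 hφ⟩, hv⟩
  · rintro v' ⟨rfl, hφ⟩
    exact ⟨M, ⟨rfl, (h M v hv).2 hφ⟩, hv⟩

/-- The model in which the values of the variables in `P` are read off from a valuation. -/
def Model.readVal (σ : V → PVar V) (P : List V) (M : Model V) (v : Set (Atm (PVar V))) :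
    Model V where
  R := M.R
  W := M.W
  val := {p | (p ∈ P ∧ Atm.var (σ p) ∈ v) ∨ (p ∉ P ∧ p ∈ M.val)}
  writable_readable := M.writable_readable

/-- Each outcome of the loop agrees on `P` with some indistinguishable model, and each
indistinguishable model agrees with some outcome. Agreement on `P` suffices because the hypothesis
`h` asks for no more, so values outside `P` do not matter. -/
theorem sat_box_vary {φ : Formula V} {φ' : TFormula V} {P : List V}
    (hσ : Function.Injective σ) (hP : P.Nodup)
    (h : ∀ M v, Agree σ P M v → (φ.Sat M ↔ φ'.Sat v)) {M : Model V} {v : Set (Atm (PVar V))}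
    (hv : Agree σ P M v) :
    (∀ M' : Model V, M'.Indist M → φ.Sat M') ↔ (DFormula.box (vary σ P) φ').Sat v := by
  rw [DFormula.sat_box]
  constructor
  · intro hM v' hv'
    -- The indistinguishable model takes its values on `P` from the outcome `v'` and keeps those of
    -- `M` elsewhere.
    refine (h (M.readVal σ P v') v' fun p hp => ?_).1 (hM _ ⟨rfl, rfl, ?_⟩)
    · have hw (a : Atm (PVar V)) (ha : ∀ q, a ≠ .var (σ q)) : a ∈ v' ↔ a ∈ v :=
        hv'.mem_iff _ a fun haw =>
          let ⟨q, _, e⟩ := base_of_mem_writes_vary haw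
          ha q e
      refine ⟨(hv p hp).1.trans (hw _ (by simp)).symm, (hv p hp).2.1.trans (hw _ (by simp)).symm, ?_⟩
      simp [Model.readVal, hp]
    · have hs := vary_sound hσ hP hv hv'
      ext p
      simp only [Model.readVal, Set.mem_inter_iff, Set.mem_ofPred_eq]
      by_cases hp : p ∈ P
      · simp only [hp, true_and, not_true, false_and, or_false]
        exact and_congr_left (hs p hp)
      · simp [hp]
  · intro hv' M' hM'
    obtain ⟨v', t, ht⟩ := vary_progress hσ hP hv hM'
    exact (h M' v' ht).2 (hv' v' t)

/-- For partial functions the two directions of a simulation share one computation. The guard `c` is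
a condition on the model, and agreement is available in `hτ` to read it off the valuation. -/
theorem Simulates.of_deterministic {f : Model V → Model V}
    {g : Set (Atm (PVar V)) → Set (Atm (PVar V))} {c : Model V → Prop} (hπ : ∀ M M', π.Run M M' ↔ M' = f M ∧ c M)
    (hτ : ∀ M v, Agree σ S M v → ∀ v', τ.Run v v' ↔ v' = g v ∧ c M)
    (h : ∀ M v, Agree σ S M v → Agree σ S (f M) (g v)) : Simulates σ S π τ := by
  intro M v hv
  constructor
  · intro M' r
    obtain ⟨rfl, hc⟩ := (hπ _ _).1 r
    exact ⟨_, (hτ M v hv _).2 ⟨rfl, hc⟩, h M v hv⟩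
  · intro v' t
    obtain ⟨rfl, hc⟩ := (hτ M v hv _).1 t
    exact ⟨_, (hπ _ _).2 ⟨rfl, hc⟩, h M v hv⟩

theorem run_model_iff {M' N : Model V} {c : Prop} :
    M' = N ∧ c ↔ M'.R = N.R ∧ M'.W = N.W ∧ M'.val = N.val ∧ c := by
  rw [Model.ext_iff]; tauto

end Simulation

-- The simulation of the assignments

section Assignments

variable {σ : V → PVar V} {S : List V} {p : V}

theorem simulates_setV (hσ : Function.Injective σ) (hp : p ∈ S) :
    Simulates σ S (.setV p) (.seq (.test (fW (σ p))) (.set (.var (σ p)))) := by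
  refine .of_deterministic (f := fun M => ⟨M.R, M.W, M.val ∪ {p}, M.writable_readable⟩)
    (g := fun v => v ∪ {.var (σ p)}) (c := fun M => p ∈ M.W) (fun M M' => ?_)
    (fun M v hv v' => ?_) fun M v hv q hq => ?_
  · rw [run_model_iff]; simp [Program.Run]
  · simp [DProgram.Run, and_assoc, (hv p hp).2.1, and_comm]
  · obtain ⟨h₁, h₂, h₃⟩ := hv q hq
    refine ⟨?_, ?_, ?_⟩ <;> simp [h₁, h₂, h₃, hσ.eq_iff]

theorem simulates_unsetV (hσ : Function.Injective σ) (hp : p ∈ S) :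
    Simulates σ S (.unsetV p) (.seq (.test (fW (σ p))) (.unset (.var (σ p)))) := by
  refine .of_deterministic (f := fun M => ⟨M.R, M.W, M.val \ {p}, M.writable_readable⟩)
    (g := fun v => v \ {.var (σ p)}) (c := fun M => p ∈ M.W) (fun M M' => ?_)
    (fun M v hv v' => ?_) fun M v hv q hq => ?_
  · rw [run_model_iff]; simp [Program.Run]
  · simp [DProgram.Run, and_assoc, (hv p hp).2.1, and_comm]
  · obtain ⟨h₁, h₂, h₃⟩ := hv q hq
    refine ⟨?_, ?_, ?_⟩ <;> simp [h₁, h₂, h₃, hσ.eq_iff]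

theorem simulates_setR (hσ : Function.Injective σ) :
    Simulates σ S (.setR p) (.set (.R (σ p))) := by
  refine .of_deterministic (f := fun M => ⟨M.R ∪ {p}, M.W, M.val,
      M.writable_readable.trans Set.subset_union_left⟩)
    (g := fun v => v ∪ {.R (σ p)}) (c := fun _ => True) (fun M M' => ?_)
    (fun M v hv v' => ?_) fun M v hv q hq => ?_
  · rw [run_model_iff]; simp [Program.Run]
  · simp [DProgram.Run]
  · obtain ⟨h₁, h₂, h₃⟩ := hv q hq
    refine ⟨?_, ?_, ?_⟩ <;> simp [h₁, h₂, h₃, hσ.eq_iff]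

theorem simulates_unsetR (hσ : Function.Injective σ) :
    Simulates σ S (.unsetR p) (.seq (.unset (.W (σ p))) (.unset (.R (σ p)))) := by
  refine .of_deterministic (f := fun M => ⟨M.R \ {p}, M.W \ {p}, M.val,
      Set.sdiff_subset_sdiff_left M.writable_readable⟩)
    (g := fun v => (v \ {.W (σ p)}) \ {.R (σ p)}) (c := fun _ => True) (fun M M' => ?_)
    (fun M v hv v' => ?_) fun M v hv q hq => ?_
  · rw [run_model_iff]; simp [Program.Run]
  · simp [DProgram.Run]
  · obtain ⟨h₁, h₂, h₃⟩ := hv q hq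
    refine ⟨?_, ?_, ?_⟩ <;> simp [h₁, h₂, h₃, hσ.eq_iff]

theorem simulates_setW (hσ : Function.Injective σ) :
    Simulates σ S (.setW p) (.seq (.set (.R (σ p))) (.set (.W (σ p)))) := by
  refine .of_deterministic (f := fun M => ⟨M.R ∪ {p}, M.W ∪ {p}, M.val,
      Set.union_subset_union_left _ M.writable_readable⟩)
    (g := fun v => (v ∪ {.R (σ p)}) ∪ {.W (σ p)}) (c := fun _ => True) (fun M M' => ?_)
    (fun M v hv v' => ?_) fun M v hv q hq => ?_
  · rw [run_model_iff]; simp [Program.Run]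
  · simp [DProgram.Run]
  · obtain ⟨h₁, h₂, h₃⟩ := hv q hq
    refine ⟨?_, ?_, ?_⟩ <;> simp [h₁, h₂, h₃, hσ.eq_iff]

theorem simulates_unsetW (hσ : Function.Injective σ) :
    Simulates σ S (.unsetW p) (.unset (.W (σ p))) := by
  refine .of_deterministic (f := fun M => ⟨M.R, M.W \ {p}, M.val,
      Set.sdiff_subset.trans M.writable_readable⟩)
    (g := fun v => v \ {.W (σ p)}) (c := fun _ => True) (fun M M' => ?_)
    (fun M v hv v' => ?_) fun M v hv q hq => ?_
  · rw [run_model_iff]; simp [Program.Run]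
  · simp [DProgram.Run]
  · obtain ⟨h₁, h₂, h₃⟩ := hv q hq
    refine ⟨?_, ?_, ?_⟩ <;> simp [h₁, h₂, h₃, hσ.eq_iff]

end Assignments

-- Correctness of the translation and satisfiability

section Correctness

variable [DecidableEq V]

theorem union_subset_iff_subset {l l' S : List V} : l ∪ l' ⊆ S ↔ l ⊆ S ∧ l' ⊆ S := by
  simp only [List.subset_def, List.mem_union_iff, or_imp, forall_and]

mutual

theorem Formula.nodup_vars : ∀ φ : Formula V, φ.vars.Nodup
  | .var p => by simp [Formula.vars]
  | .top => by simp [Formula.vars]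
  | .neg φ => by simpa [Formula.vars] using Formula.nodup_vars φ
  | .or φ ψ => by simpa only [Formula.vars] using (Formula.nodup_vars ψ).union _
  | .dia π φ => by simpa only [Formula.vars] using (Formula.nodup_vars φ).union _

theorem Program.nodup_vars : ∀ π : Program V, π.vars.Nodup
  | .setV p => by simp [Program.vars]
  | .unsetV p => by simp [Program.vars]
  | .setR p => by simp [Program.vars]
  | .unsetR p => by simp [Program.vars]
  | .setW p => by simp [Program.vars]
  | .unsetW p => by simp [Program.vars]
  | .test φ => by simpa [Program.vars] using Formula.nodup_vars φ
  | .endoTest φ => by simpa [Program.vars] using Formula.nodup_vars φ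
  | .seq π ρ => by simpa only [Program.vars] using (Program.nodup_vars ρ).union _
  | .choice π ρ => by simpa only [Program.vars] using (Program.nodup_vars ρ).union _
  | .star π => by simpa [Program.vars] using Program.nodup_vars π
  | .par π ρ => by simpa only [Program.vars] using (Program.nodup_vars ρ).union _

end

theorem writesCopies_transAt (π : Program V) (b : Bool) (o : List Bool) (k : Side) :
    WritesCopies o k (π.transAt (b :: o) (.copy o k)) := fun _ ha =>
  (base_of_mem_writes_transAt π _ _ ha).imp (fun ⟨p, _, h⟩ => ⟨p, h⟩) fun h => ⟨b, h⟩

mutual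

theorem Formula.sat_transAt : ∀ (φ : Formula V) (o : List Bool) (σ : V → PVar V) (S : List V),
    Outside o σ → φ.vars ⊆ S → ∀ M v, Agree σ S M v → (φ.Sat M ↔ (φ.transAt o σ).Sat v)
  | .var p, o, σ, S, _, hS, M, v, hv => by
      simpa [Formula.Sat, Formula.transAt] using (hv p (hS (by simp [Formula.vars]))).2.2
  | .top, o, σ, S, _, _, M, v, _ => by simp [Formula.Sat, Formula.transAt, DFormula.Sat]
  | .neg φ, o, σ, S, ho, hS, M, v, hv => by
      simp only [Formula.Sat, Formula.transAt, DFormula.sat_neg]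
      exact not_congr (Formula.sat_transAt φ _ σ S (ho.cons _) (by simpa [Formula.vars] using hS) M v hv)
  | .or φ ψ, o, σ, S, ho, hS, M, v, hv => by
      simp only [Formula.vars, union_subset_iff_subset] at hS
      simp only [Formula.Sat, Formula.transAt, DFormula.sat_or]
      exact or_congr (Formula.sat_transAt φ _ σ S (ho.cons _) hS.1 M v hv)
        (Formula.sat_transAt ψ _ σ S (ho.cons _) hS.2 M v hv)
  | .dia π φ, o, σ, S, ho, hS, M, v, hv => by
      simp only [Formula.vars, union_subset_iff_subset] at hS
      simp only [Formula.Sat, Formula.transAt, DFormula.Sat]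
      have hπ := Program.simulates_transAt π _ σ S (ho.cons false) hS.1 M v hv
      have hφ := Formula.sat_transAt φ _ σ S (ho.cons true) hS.2
      constructor
      · rintro ⟨M', r, h⟩
        obtain ⟨v', t, hv'⟩ := hπ.1 M' r
        exact ⟨v', t, (hφ M' v' hv').1 h⟩
      · rintro ⟨v', t, h⟩
        obtain ⟨M', r, hv'⟩ := hπ.2 v' t
        exact ⟨M', r, (hφ M' v' hv').2 h⟩

theorem Program.simulates_transAt : ∀ (π : Program V) (o : List Bool) (σ : V → PVar V)
    (S : List V), Outside o σ → π.vars ⊆ S → Simulates σ S π (π.transAt o σ)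
  | .setV p, o, σ, S, ho, hS => by
      simpa only [Program.transAt] using simulates_setV ho.inj (hS (by simp [Program.vars]))
  | .unsetV p, o, σ, S, ho, hS => by
      simpa only [Program.transAt] using simulates_unsetV ho.inj (hS (by simp [Program.vars]))
  | .setR p, o, σ, S, ho, _ => by simpa only [Program.transAt] using simulates_setR ho.inj
  | .unsetR p, o, σ, S, ho, _ => by simpa only [Program.transAt] using simulates_unsetR ho.inj
  | .setW p, o, σ, S, ho, _ => by simpa only [Program.transAt] using simulates_setW ho.inj
  | .unsetW p, o, σ, S, ho, _ => by simpa only [Program.transAt] using simulates_unsetW ho.inj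
  | .test φ, o, σ, S, ho, hS => by
      simpa only [Program.transAt] using Simulates.test
        (Formula.sat_transAt φ _ σ S (ho.cons _) (by simpa [Program.vars] using hS))
  | .endoTest φ, o, σ, S, ho, hS => by
      -- The induction hypothesis is used with the variables of `φ` instead of `S`, since the loop
      -- varies only these.
      have hφ := Formula.sat_transAt φ _ σ φ.vars (ho.cons false) (List.Subset.refl _)
      have hS : φ.vars ⊆ S := by simpa [Program.vars] using hS
      have key := fun {M v} (hv : Agree σ S M v) => sat_box_vary ho.inj φ.nodup_vars hφ
        fun p hp => hv p (hS hp)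
      simp only [Program.transAt]
      intro M v hv
      constructor
      · rintro M' ⟨rfl, h⟩
        exact ⟨v, ⟨rfl, (key hv).1 h⟩, hv⟩
      · rintro v' ⟨rfl, h⟩
        exact ⟨M, ⟨rfl, (key hv).2 h⟩, hv⟩
  | .seq π ρ, o, σ, S, ho, hS => by
      simp only [Program.vars, union_subset_iff_subset] at hS
      simpa only [Program.transAt] using (Program.simulates_transAt π _ σ S (ho.cons _) hS.1).seq
        (Program.simulates_transAt ρ _ σ S (ho.cons _) hS.2)
  | .choice π ρ, o, σ, S, ho, hS => by
      simp only [Program.vars, union_subset_iff_subset] at hS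
      simpa only [Program.transAt] using (Program.simulates_transAt π _ σ S (ho.cons _) hS.1).choice
        (Program.simulates_transAt ρ _ σ S (ho.cons _) hS.2)
  | .star π, o, σ, S, ho, hS => by
      simpa only [Program.transAt] using
        (Program.simulates_transAt π _ σ S (ho.cons _) (by simpa [Program.vars] using hS)).star
  | .par π ρ, o, σ, S, ho, hS => by
      simp only [Program.vars] at hS
      simp only [Program.transAt]
      exact .par ho (ρ.nodup_vars.union _) hS (writesCopies_transAt π _ o .one)
        (writesCopies_transAt ρ _ o .two)
        (Program.simulates_transAt π _ _ _ (outside_copy _ _ _)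
          fun p hp => List.mem_union_iff.2 (.inl hp))
        (Program.simulates_transAt ρ _ _ _ (outside_copy _ _ _)
          fun p hp => List.mem_union_iff.2 (.inr hp))

end

theorem Formula.satisfiable_iff (φ : Formula V) : φ.Satisfiable ↔
    (DFormula.and φ.trans (inclusion φ.vars)).Satisfiable := by
  have hφ := φ.sat_transAt [] PVar.orig φ.vars (outside_orig _) (List.Subset.refl _)
  have hi (v : Set (Atm (PVar V))) : (inclusion φ.vars).Sat v ↔
      ∀ p ∈ φ.vars, Atm.W (.orig p) ∈ v → Atm.R (.orig p) ∈ v := by simp [inclusion]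
  constructor
  · rintro ⟨M, hM⟩
    let v : Set (Atm (PVar V)) := fun a => match a with
      | .var (.orig p) => p ∈ M.val
      | .R (.orig p) => p ∈ M.R
      | .W (.orig p) => p ∈ M.W
      | _ => False
    refine ⟨v, DFormula.sat_and.2 ⟨(hφ M v fun p _ => ⟨Iff.rfl, Iff.rfl, Iff.rfl⟩).1 hM, ?_⟩⟩
    exact (hi v).2 fun p _ h => M.writable_readable h
  · rintro ⟨v, hv⟩
    obtain ⟨hv, hi'⟩ := DFormula.sat_and.1 hv
    rw [hi] at hi'
    -- The inclusion formula constrains only the variables of `φ`, so the permissions are cut down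
    -- to them to ensure `W ⊆ R`; values need no restriction.
    refine ⟨⟨{p | p ∈ φ.vars ∧ Atm.R (.orig p) ∈ v}, {p | p ∈ φ.vars ∧ Atm.W (.orig p) ∈ v},
      {p | Atm.var (.orig p) ∈ v}, fun p hp => ⟨hp.1, hi' p hp.1 hp.2⟩⟩, (hφ _ v ?_).2 hv⟩
    intro p hp
    simp [AgreeAt, hp]

end Correctness

-- Size of the translation

section Sizes

variable {w : A → ℕ}

theorem DProgram.size_bigSeq_le {X : Type u} {l : List X} {f : X → DProgram A} {C : ℕ}
    (h : ∀ x ∈ l, (f x).size w ≤ C) : (bigSeq l f).size w ≤ l.length * (C + 1) + 2 := by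
  induction l with
  | nil => simp [bigSeq, skip, DProgram.size, DFormula.size]
  | cons x l ih =>
    have h₁ := h x (by simp)
    have h₂ := ih fun y hy => h y (by simp [hy])
    have : (bigSeq (x :: l) f).size w = (f x).size w + (bigSeq l f).size w + 1 := rfl
    rw [this, List.length_cons, add_mul]
    omega

theorem DFormula.size_bigAnd_le {X : Type u} {l : List X} {f : X → DFormula A} {C : ℕ}
    (h : ∀ x ∈ l, (f x).size w ≤ C) : (bigAnd l f).size w ≤ l.length * (C + 4) + 1 := by
  induction l with
  | nil => simp [bigAnd, DFormula.size]
  | cons x l ih =>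
    have h₁ := h x (by simp)
    have h₂ := ih fun y hy => h y (by simp [hy])
    have : (bigAnd (x :: l) f).size w = (f x).size w + 1 + ((bigAnd l f).size w + 1) + 1 + 1 := rfl
    rw [this, List.length_cons, add_mul]
    omega

end Sizes

theorem PVar.size_copy (o : List Bool) (k : Side) (p : V) :
    (PVar.copy o k p).size = o.length + 3 := rfl

theorem PVar.size_copyR (o : List Bool) (k : Side) (p : V) :
    (PVar.copyR o k p).size = o.length + 3 := rfl

theorem PVar.size_copyW (o : List Bool) (k : Side) (p : V) :
    (PVar.copyW o k p).size = o.length + 3 := rfl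

section BodySizes

open DProgram DFormula

variable {o : List Bool} {σ : V → PVar V} {P : List V} {B : ℕ}

theorem size_split_le (hσ : ∀ p, (σ p).size + 1 ≤ B) (ho : o.length + 4 ≤ B) :
    (split o σ P).size Atm.size ≤ P.length * (100 * B + 1) + 2 := by
  refine size_bigSeq_le fun p _ => ?_
  have := hσ p
  simp only [DProgram.size, DFormula.size, DFormula.and, fv, fR, fW, Atm.size, PVar.size_copy]
  omega

theorem size_store_le (ho : o.length + 4 ≤ B) :
    (store o P).size Atm.size ≤ P.length * (100 * B + 1) + 2 := by
  refine size_bigSeq_le fun p _ => ?_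
  simp only [DProgram.size, DFormula.size, assign, fR, fW, Atm.size, PVar.size_copy, PVar.size_copyR,
    PVar.size_copyW]
  omega

theorem size_okChange_le (hσ : ∀ p, (σ p).size + 1 ≤ B) (ho : o.length + 4 ≤ B) :
    (okChange o σ P).size Atm.size ≤ P.length * (100 * B + 4) + 1 := by
  refine size_bigAnd_le fun p _ => ?_
  have := hσ p
  simp only [DFormula.size, DFormula.and, DFormula.iff, DFormula.imp, fv, fR, fW, Atm.size,
    PVar.size_copy, PVar.size_copyR,
    PVar.size_copyW]
  omega

theorem size_merge_le (hσ : ∀ p, (σ p).size + 1 ≤ B) (ho : o.length + 4 ≤ B) :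
    (merge o σ P).size Atm.size ≤ P.length * (100 * B + 1) + 2 := by
  refine size_bigSeq_le fun p _ => ?_
  have := hσ p
  simp only [DProgram.size, DFormula.size, DFormula.and, fv, fW, Atm.size, PVar.size_copy, PVar.size_copyR,
    PVar.size_copyW]
  omega

theorem size_vary_le (hσ : ∀ p, (σ p).size + 1 ≤ B) (hB : 4 ≤ B) :
    (vary σ P).size Atm.size ≤ P.length * (100 * B + 1) + 2 := by
  refine size_bigSeq_le fun p _ => ?_
  have := hσ p
  simp only [DProgram.size, DFormula.size, fR, Atm.size]
  omega

/-- Each of the four blocks (three loops and the test) costs about `100 * (B * B)`; the fifth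
hundred absorbs the lower-order terms, using `4 ≤ B`. -/
theorem size_flatten_le {τ₁ τ₂ : TProgram V} (hσ : ∀ p, (σ p).size + 1 ≤ B)
    (ho : o.length + 4 ≤ B) (hP : P.length ≤ B) : (flatten o σ P τ₁ τ₂).size Atm.size ≤
      τ₁.size Atm.size + τ₂.size Atm.size + 500 * (B * B) := by
  have h₁ := size_split_le (P := P) hσ ho
  have h₂ := size_store_le (P := P) ho
  have h₃ := size_okChange_le (P := P) hσ ho
  have h₄ := size_merge_le (P := P) hσ ho
  have h₅ : P.length * (100 * B + 1) ≤ B * (100 * B + 1) := Nat.mul_le_mul_right _ hP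
  have h₆ : P.length * (100 * B + 4) ≤ B * (100 * B + 4) := Nat.mul_le_mul_right _ hP
  have h₇ : 4 * B ≤ B * B := Nat.mul_le_mul_right _ (by omega)
  have e₁ : B * (100 * B + 1) = 100 * (B * B) + B := by ring
  have e₂ : B * (100 * B + 4) = 100 * (B * B) + 4 * B := by ring
  simp only [flatten, DProgram.size]
  omega

end BodySizes

section TranslationSize

variable [DecidableEq V]

theorem length_union_le (l l' : List V) : (l ∪ l').length ≤ l.length + l'.length := by
  induction l with
  | nil => simp
  | cons a l ih =>
    rw [List.cons_union, List.length_cons]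
    rw [List.length_insert]
    split <;> omega

mutual

theorem Formula.length_vars_le : ∀ φ : Formula V, φ.vars.length ≤ φ.size
  | .var p => by simp [Formula.vars, Formula.size]
  | .top => by simp [Formula.vars, Formula.size]
  | .neg φ => by
      have := Formula.length_vars_le φ
      simp only [Formula.vars, Formula.size]; omega
  | .or φ ψ => by
      have := Formula.length_vars_le φ
      have := Formula.length_vars_le ψ
      have := length_union_le φ.vars ψ.vars
      simp only [Formula.vars, Formula.size]; omega
  | .dia π φ => by
      have := Program.length_vars_le π
      have := Formula.length_vars_le φ
      have := length_union_le π.vars φ.vars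
      simp only [Formula.vars, Formula.size]; omega

theorem Program.length_vars_le : ∀ π : Program V, π.vars.length ≤ π.size
  | .setV p => by simp [Program.vars, Program.size]
  | .unsetV p => by simp [Program.vars, Program.size]
  | .setR p => by simp [Program.vars, Program.size]
  | .unsetR p => by simp [Program.vars, Program.size]
  | .setW p => by simp [Program.vars, Program.size]
  | .unsetW p => by simp [Program.vars, Program.size]
  | .test φ => by
      have := Formula.length_vars_le φ
      simp only [Program.vars, Program.size]; omega
  | .endoTest φ => by
      have := Formula.length_vars_le φ
      simp only [Program.vars, Program.size]; omega
  | .seq π ρ => by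
      have := Program.length_vars_le π
      have := Program.length_vars_le ρ
      have := length_union_le π.vars ρ.vars
      simp only [Program.vars, Program.size]; omega
  | .choice π ρ => by
      have := Program.length_vars_le π
      have := Program.length_vars_le ρ
      have := length_union_le π.vars ρ.vars
      simp only [Program.vars, Program.size]; omega
  | .star π => by
      have := Program.length_vars_le π
      simp only [Program.vars, Program.size]; omega
  | .par π ρ => by
      have := Program.length_vars_le π
      have := Program.length_vars_le ρ
      have := length_union_le π.vars ρ.vars
      simp only [Program.vars, Program.size]; omega

end

mutual

/-- If `B` bounds the sizes of all the atoms and the number of all the variables that can occur in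
the translation, every symbol contributes at most `500 * B ^ 2` symbols to the translation. -/
theorem Formula.size_transAt_le (B : ℕ) : ∀ (φ : Formula V) (o : List Bool) (σ : V → PVar V),
    (∀ p, (σ p).size + 1 ≤ B) → o.length + φ.size + 4 ≤ B →
    (φ.transAt o σ).size Atm.size ≤ 500 * (B * B) * φ.size
  | .var p, o, σ, hσ, ho => by
      have := hσ p
      have h : B ≤ B * B := Nat.le_mul_self B
      simp only [Formula.transAt, fv, DFormula.size, Atm.size, Formula.size]
      omega
  | .top, o, σ, hσ, ho => by
      have h : B ≤ B * B := Nat.le_mul_self B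
      simp only [Formula.transAt, DFormula.size, Formula.size]
      omega
  | .neg φ, o, σ, hσ, ho => by
      have h : B ≤ B * B := Nat.le_mul_self B
      simp only [Formula.size] at ho
      -- Each descent lengthens the address by one and shortens the expression by at least one, so
      -- the same `B` serves throughout the recursion.
      have h₁ := Formula.size_transAt_le B φ (false :: o) σ hσ
        (by rw [List.length_cons]; omega)
      simp only [Formula.transAt, DFormula.size, Formula.size, mul_add]
      omega
  | .or φ ψ, o, σ, hσ, ho => by
      have h : B ≤ B * B := Nat.le_mul_self B
      simp only [Formula.size] at ho
      have h₁ := Formula.size_transAt_le B φ (false :: o) σ hσ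
        (by rw [List.length_cons]; omega)
      have h₂ := Formula.size_transAt_le B ψ (true :: o) σ hσ
        (by rw [List.length_cons]; omega)
      simp only [Formula.transAt, DFormula.size, Formula.size, mul_add]
      omega
  | .dia π φ, o, σ, hσ, ho => by
      have h : B ≤ B * B := Nat.le_mul_self B
      simp only [Formula.size] at ho
      have h₁ := Program.size_transAt_le B π (false :: o) σ hσ
        (by rw [List.length_cons]; omega)
      have h₂ := Formula.size_transAt_le B φ (true :: o) σ hσ
        (by rw [List.length_cons]; omega)
      simp only [Formula.transAt, DFormula.size, Formula.size, mul_add]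
      omega

theorem Program.size_transAt_le (B : ℕ) : ∀ (π : Program V) (o : List Bool) (σ : V → PVar V),
    (∀ p, (σ p).size + 1 ≤ B) → o.length + π.size + 4 ≤ B →
    (π.transAt o σ).size Atm.size ≤ 500 * (B * B) * π.size
  | .setV p, o, σ, hσ, ho
  | .unsetV p, o, σ, hσ, ho
  | .setR p, o, σ, hσ, ho
  | .unsetR p, o, σ, hσ, ho
  | .setW p, o, σ, hσ, ho
  | .unsetW p, o, σ, hσ, ho => by
      have := hσ p
      have h : B ≤ B * B := Nat.le_mul_self B
      simp only [Program.transAt, fW, DProgram.size, DFormula.size, Atm.size, Program.size]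
      omega
  | .test φ, o, σ, hσ, ho => by
      have h : B ≤ B * B := Nat.le_mul_self B
      simp only [Program.size] at ho
      have h₁ := Formula.size_transAt_le B φ (false :: o) σ hσ
        (by rw [List.length_cons]; omega)
      simp only [Program.transAt, DProgram.size, Program.size, mul_add]
      omega
  | .endoTest φ, o, σ, hσ, ho => by
      simp only [Program.size] at ho
      have h₁ := Formula.size_transAt_le B φ (false :: o) σ hσ
        (by rw [List.length_cons]; omega)
      have h₂ := size_vary_le (P := φ.vars) hσ (by omega)
      have h₃ := φ.length_vars_le
      have h₄ : φ.vars.length * (100 * B + 1) ≤ B * (100 * B + 1) :=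
        Nat.mul_le_mul_right _ (by omega)
      have h₅ : 4 * B ≤ B * B := Nat.mul_le_mul_right _ (by omega)
      have e : B * (100 * B + 1) = 100 * (B * B) + B := by ring
      simp only [Program.transAt, DProgram.size, DFormula.box, DFormula.size, Program.size,
        mul_add]
      omega
  | .seq π ρ, o, σ, hσ, ho
  | .choice π ρ, o, σ, hσ, ho => by
      have h : B ≤ B * B := Nat.le_mul_self B
      simp only [Program.size] at ho
      have h₁ := Program.size_transAt_le B π (false :: o) σ hσ
        (by rw [List.length_cons]; omega)
      have h₂ := Program.size_transAt_le B ρ (true :: o) σ hσ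
        (by rw [List.length_cons]; omega)
      simp only [Program.transAt, DProgram.size, Program.size, mul_add]
      omega
  | .star π, o, σ, hσ, ho => by
      have h : B ≤ B * B := Nat.le_mul_self B
      simp only [Program.size] at ho
      have h₁ := Program.size_transAt_le B π (false :: o) σ hσ
        (by rw [List.length_cons]; omega)
      simp only [Program.transAt, DProgram.size, Program.size, mul_add]
      omega
  | .par π ρ, o, σ, hσ, ho => by
      simp only [Program.size] at ho
      -- The renaming changes here: a copy has a name of `o.length + 3` symbols, and one more for
      -- `R` or `W` stays within `B`.
      have h₁ := Program.size_transAt_le B π (false :: o) (PVar.copy o .one)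
        (fun p => by simp only [PVar.size]; omega) (by rw [List.length_cons]; omega)
      have h₂ := Program.size_transAt_le B ρ (true :: o) (PVar.copy o .two)
        (fun p => by simp only [PVar.size]; omega) (by rw [List.length_cons]; omega)
      have h₃ := π.length_vars_le
      have h₄ := ρ.length_vars_le
      have h₅ := length_union_le π.vars ρ.vars
      have h₆ := size_flatten_le (o := o) (P := π.vars ∪ ρ.vars)
        (τ₁ := π.transAt (false :: o) (PVar.copy o .one))
        (τ₂ := ρ.transAt (true :: o) (PVar.copy o .two)) hσ (by omega) (by omega)
      simp only [Program.transAt, Program.size, mul_add]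
      omega

end

end TranslationSize

theorem size_inclusion_le (P : List V) : (inclusion P).size Atm.size ≤ P.length * 10 + 1 := by
  refine DFormula.size_bigAnd_le (C := 6) fun p _ => ?_
  simp [DFormula.size, DFormula.imp, fR, fW, Atm.size, PVar.size]

end DLPAPar

theorem mainTheorem4 {V : Type u} [DecidableEq V] :
    (∀ φ : DLPAPar.Formula V,
      φ.Satisfiable ↔
        (DLPAPar.DFormula.and φ.trans (DLPAPar.inclusion φ.vars)).Satisfiable) ∧
    (∃ f : Polynomial ℕ,
      (∀ φ : DLPAPar.Formula V,
        φ.trans.size DLPAPar.Atm.size ≤ f.eval φ.size ∧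
        (DLPAPar.DFormula.and φ.trans (DLPAPar.inclusion φ.vars)).size DLPAPar.Atm.size
          ≤ f.eval φ.size) ∧
      (∀ π : DLPAPar.Program V,
        π.trans.size DLPAPar.Atm.size ≤ f.eval π.size)) := by
  -- The cubic term comes from `B = |φ| + 4` at the empty address. The inclusions contribute at most
  -- `10 * |φ| + 1`, and the outer conjunction four more symbols.
  refine ⟨DLPAPar.Formula.satisfiable_iff,
    500 * ((.X + 4) * (.X + 4)) * .X + 10 * .X + 5, fun φ => ?_, fun π => ?_⟩
  · have h₁ := φ.size_transAt_le (φ.size + 4) [] DLPAPar.PVar.orig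
      (fun p => by simp [DLPAPar.PVar.size]) (by simp)
    have h₂ := DLPAPar.size_inclusion_le φ.vars
    have h₃ := φ.length_vars_le
    simp only [DLPAPar.Formula.trans, DLPAPar.DFormula.and, DLPAPar.DFormula.size,
      Polynomial.eval_add, Polynomial.eval_mul, Polynomial.eval_X, Polynomial.eval_ofNat]
    constructor <;> omega
  · have h₁ := π.size_transAt_le (π.size + 4) [] DLPAPar.PVar.orig
      (fun p => by simp [DLPAPar.PVar.size]) (by simp)
    simp only [DLPAPar.Program.trans,
      Polynomial.eval_add, Polynomial.eval_mul, Polynomial.eval_X, Polynomial.eval_ofNat]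
    omega
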